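/- Let $N\ge 1$ be an integer and let $\Omega\subset\mathbb C$ be a set such that $\varphi(z)=z^N$ maps $\Omega$ into itself. Let $K$ and $\widetilde K$ be Hermitian kernels on $\Omega$, with values in $\mathbb C^{p\times p}$ and $\mathbb C^{q\times q}$ respectively, which have finite numbers $\nu_-(K)$ and $\nu_-(\widetilde K)$ of negative squares, and assume that $$\nu_-(\widetilde K)=N\,\nu_-(K).$$ Here $K$ has $\kappa$ negative squares if all Hermitian block matrices $(K(w_\ell,w_j))_{\ell,j=1}^{M}$, $w_1,\dots,w_M\in\Omega$, have at most $\kappa$ strictly negative eigenvalues (counted with multiplicity) and some of them has exactly $\kappa$. Let $\mathcal P(K)$ and $\mathcal P(\widetilde K)$ be the associated reproducing kernel Pontryagin spaces of $\mathbb C^p$-valued, respectively $\mathbb C^q$-valued, functions on $\Omega$. Let $m_0,\dots,m_{N-1}$ be $\mathbb C^{q\times p}$-valued functions on $\Omega$, and assume that the kernel $$\widetilde K(z,w)-\sum_{n=0}^{N-1}m_n(z)\,K(z^N,w^N)\,m_n(w)^*$$ is positive definite in $\Omega$. (For $p=q$ and scalar functions $m_n$ it is $\widetilde K(z,w)-\bigl(\sum_{n=0}^{N-1}m_n(z)m_n(w)^*\bigr)K(z^N,w^N)$.)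 Then: 1. For all $f_0,\dots,f_{N-1}\in\mathcal P(K)$ the function $z\mapsto\sum_{n=0}^{N-1}m_n(z)f_n(z^N)$ belongs to $\mathcal P(\widetilde K)$, and the map $(f_0,\dots,f_{N-1})\mapsto\sum_{n=0}^{N-1}m_n(z)f_n(z^N)$ is a contraction from $\mathcal P(K)^N$ into $\mathcal P(\widetilde K)$: the inner square of the image is at most $\sum_{n=0}^{N-1}[f_n,f_n]_{\mathcal P(K)}$. 2. Consequently each operator $(T_{m_n,\varphi}g)(z)=m_n(z)g(z^N)$ maps $\mathcal P(K)$ into $\mathcal P(\widetilde K)$ and has an everywhere defined adjoint $T_{m_n,\varphi}^{[*]}:\mathcal P(\widetilde K)\to\mathcal P(K)$ with respect to the indefinite inner products, and for every choice of $f_0,\dots,f_{N-1}\in\mathcal P(\widetilde K)$ the functions $g_n=T_{m_n,\varphi}^{[*]}f_n\in\mathcal P(K)$ give a decomposition $$f(z)=\sum_{n=0}^{N-1}m_n(z)g_n(z^N)$$ of an element $f$ of $\mathcal P(\widetilde K)$. -/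

import Mathlib

open scoped ComplexOrder Matrix

namespace PontryaginKernel

/-! ### Matrix-valued kernels and their negative squares -/

/-- The block matrix whose `(ℓ, j)` block entry is `K (w ℓ) (w j)`. -/
def gram {X : Type*} {p M : ℕ} (K : X → X → Matrix (Fin p) (Fin p) ℂ) (w : Fin M → X) :
    Matrix (Fin M × Fin p) (Fin M × Fin p) ℂ :=
  Matrix.of fun a b => K (w a.1) (w b.1) a.2 b.2

/-- A kernel is Hermitian if `K(z,w)^* = K(w,z)` for all `z, w`. -/
def IsHermitianKernel {X : Type*} {p : ℕ} (K : X → X → Matrix (Fin p) (Fin p) ℂ) : Prop :=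
  ∀ z w, (K z w)ᴴ = K w z

theorem IsHermitianKernel.gram {X : Type*} {p M : ℕ} {K : X → X → Matrix (Fin p) (Fin p) ℂ}
    (hK : IsHermitianKernel K) (w : Fin M → X) : (gram K w).IsHermitian := by
  ext a b
  have h := congrFun (congrFun (hK (w b.1) (w a.1)) a.2) b.2
  simpa [PontryaginKernel.gram] using h

/-- A kernel is positive definite if it is Hermitian and all its block matrices
`(K(w_ℓ, w_j))` are nonnegative. -/
def IsPosDefKernel {X : Type*} {p : ℕ} (K : X → X → Matrix (Fin p) (Fin p) ℂ) : Prop :=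
  IsHermitianKernel K ∧ ∀ (M : ℕ) (w : Fin M → X), (gram K w).PosSemidef

/-- The number of strictly negative eigenvalues of a Hermitian matrix, with multiplicity. -/
noncomputable def negEigenvalueCount {n : Type*} [Fintype n] [DecidableEq n] {A : Matrix n n ℂ}
    (hA : A.IsHermitian) : ℕ :=
  Nat.card {i : n // hA.eigenvalues i < 0}

/-- The kernel `K` has `κ` negative squares: it is Hermitian, every block matrix
`(K(w_ℓ, w_j))` has at most `κ` strictly negative eigenvalues, and some such block matrix has
exactly `κ` of them. -/
def HasNegativeSquares {X : Type*} {p : ℕ} (K : X → X → Matrix (Fin p) (Fin p) ℂ) (κ : ℕ) :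
    Prop :=
  ∃ hK : IsHermitianKernel K,
    (∀ (M : ℕ) (w : Fin M → X), negEigenvalueCount (hK.gram w) ≤ κ) ∧
    ∃ (M : ℕ) (w : Fin M → X), negEigenvalueCount (hK.gram w) = κ

/-! ### Pontryagin spaces

Forms are written `B f g = [f, g]`: linear in the first and conjugate linear in the second
variable. -/

/-- The subspace `W` is a Hilbert space for the form `B`: the form is positive definite on `W`,
and `W` is complete for the norm `[f, f]^{1/2}`. -/
def IsHilbertOn {V : Type*} [AddCommGroup V] [Module ℂ V] (B : V →ₗ[ℂ] V →ₗ⋆[ℂ] ℂ)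
    (W : Submodule ℂ V) : Prop :=
  (∀ f ∈ W, f ≠ 0 → 0 < (B f f).re) ∧
  ∀ u : ℕ → V, (∀ n, u n ∈ W) →
    (∀ ε : ℝ, 0 < ε → ∃ n₀ : ℕ, ∀ m ≥ n₀, ∀ n ≥ n₀, (B (u m - u n) (u m - u n)).re < ε) →
    ∃ f ∈ W, Filter.Tendsto (fun n => (B (u n - f) (u n - f)).re) Filter.atTop (nhds 0)

/-- `(V, B)` is a Pontryagin space: the form is Hermitian and `V` is the direct and orthogonal sum
of a subspace `V₊` which is a Hilbert space for the form, and of a finite dimensional subspace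
`V₋` on which the form is negative definite (`V₋` is then a Hilbert space for the opposite form,
completeness being automatic in finite dimension). -/
def IsPontryagin {V : Type*} [AddCommGroup V] [Module ℂ V] (B : V →ₗ[ℂ] V →ₗ⋆[ℂ] ℂ) : Prop :=
  (∀ f g, B g f = star (B f g)) ∧
  ∃ Vp Vm : Submodule ℂ V, IsCompl Vp Vm ∧ (∀ f ∈ Vp, ∀ g ∈ Vm, B f g = 0) ∧
    IsHilbertOn B Vp ∧ FiniteDimensional ℂ Vm ∧ ∀ f ∈ Vm, f ≠ 0 → (B f f).re < 0

/-- The form `∑ n, [f n, g n]` of the direct sum `V^N`. -/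
noncomputable def sumForm {V : Type*} [AddCommGroup V] [Module ℂ V] (N : ℕ)
    (B : V →ₗ[ℂ] V →ₗ⋆[ℂ] ℂ) : (Fin N → V) →ₗ[ℂ] (Fin N → V) →ₗ⋆[ℂ] ℂ :=
  LinearMap.mk₂'ₛₗ (RingHom.id ℂ) (starRingEnd ℂ) (fun f g => ∑ n, B (f n) (g n))
    (by intros; simp [Finset.sum_add_distrib]) (by intros; simp [Finset.mul_sum])
    (by intros; simp [Finset.sum_add_distrib]) (by intros; simp [Finset.mul_sum])

/-- A contraction: an everywhere defined operator with `[A f, A f]₂ ≤ [f, f]₁`. -/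
def IsContraction {V₁ V₂ : Type*} [AddCommGroup V₁] [Module ℂ V₁] [AddCommGroup V₂] [Module ℂ V₂]
    (B₁ : V₁ →ₗ[ℂ] V₁ →ₗ⋆[ℂ] ℂ) (B₂ : V₂ →ₗ[ℂ] V₂ →ₗ⋆[ℂ] ℂ) (A : V₁ →ₗ[ℂ] V₂) : Prop :=
  ∀ f, (B₂ (A f) (A f)).re ≤ (B₁ f f).re

/-- `A'` is the adjoint `A^{[*]}` of `A` with respect to the (indefinite) inner products:
`[A f, g]₂ = [f, A' g]₁` for all `f, g`. -/
def IsAdjoint {V₁ V₂ : Type*} [AddCommGroup V₁] [Module ℂ V₁] [AddCommGroup V₂] [Module ℂ V₂]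
    (B₁ : V₁ →ₗ[ℂ] V₁ →ₗ⋆[ℂ] ℂ) (B₂ : V₂ →ₗ[ℂ] V₂ →ₗ⋆[ℂ] ℂ) (A : V₁ →ₗ[ℂ] V₂)
    (A' : V₂ →ₗ[ℂ] V₁) : Prop :=
  ∀ f g, B₂ (A f) g = B₁ f (A' g)

/-! ### Reproducing kernel Pontryagin spaces -/

/-- A Pontryagin space of `ℂ^p`-valued functions on `X`. -/
structure PontryaginFunctionSpace (X : Type*) (p : ℕ) where
  /-- the functions that belong to the space -/
  carrier : Submodule ℂ (X → Fin p → ℂ)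
  /-- the indefinite inner product -/
  form : carrier →ₗ[ℂ] carrier →ₗ⋆[ℂ] ℂ
  isPontryagin : IsPontryagin form

/-- `P` is the reproducing kernel Pontryagin space `𝒫(K)`: for all `w` and `ξ` the function
`K(·, w) ξ` belongs to `P`, and `[f, K(·, w) ξ] = ξ^* f(w)` for every `f` in `P`. -/
def PontryaginFunctionSpace.HasKernel {X : Type*} {p : ℕ} (P : PontryaginFunctionSpace X p)
    (K : X → X → Matrix (Fin p) (Fin p) ℂ) : Prop :=
  ∀ (w : X) (ξ : Fin p → ℂ), ∃ h : (fun z => K z w *ᵥ ξ) ∈ P.carrier,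
    ∀ f : P.carrier, P.form f ⟨fun z => K z w *ᵥ ξ, h⟩ = star ξ ⬝ᵥ (f : X → Fin p → ℂ) w

/-! ### Existence of the reproducing kernel Pontryagin space -/

section Existence

variable {Y : Type*}

/-- The function `k a = ∑ y', k(·, y') a(y')` for a finitely supported `a`. -/
noncomputable def kmul (k : Y → Y → ℂ) : (Y →₀ ℂ) →ₗ[ℂ] (Y → ℂ) :=
  Finsupp.linearCombination ℂ (fun y' y => k y y')

/-- The pairing `a^* g = ∑ y, conj a(y) g(y)`. -/
noncomputable def pair (a : Y →₀ ℂ) : (Y → ℂ) →ₗ[ℂ] ℂ :=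
  ∑ y ∈ a.support, (star (a y)) • LinearMap.proj y

theorem pair_eq (a : Y →₀ ℂ) (g : Y → ℂ) : pair a g = a.sum fun y c => star c * g y := by
  simp [pair, Finsupp.sum]

theorem pair_add (a b : Y →₀ ℂ) (g : Y → ℂ) : pair (a + b) g = pair a g + pair b g := by
  simp only [pair_eq]
  rw [Finsupp.sum_add_index'] <;> simp [add_mul]

theorem pair_smul (c : ℂ) (a : Y →₀ ℂ) (g : Y → ℂ) :
    pair (c • a) g = star c * pair a g := by
  simp only [pair_eq]
  rw [Finsupp.sum_smul_index] <;> simp [Finsupp.mul_sum, mul_assoc]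

theorem pair_zero (g : Y → ℂ) : pair (0 : Y →₀ ℂ) g = 0 := by
  simp [pair]

theorem pair_sum {ι : Type*} (s : Finset ι) (a : ι → Y →₀ ℂ) (g : Y → ℂ) :
    pair (∑ i ∈ s, a i) g = ∑ i ∈ s, pair (a i) g := by
  classical
  induction s using Finset.induction_on with
  | empty => simp [pair_zero]
  | insert i s hi ih => simp [Finset.sum_insert hi, pair_add, ih]

theorem kmul_apply (k : Y → Y → ℂ) (a : Y →₀ ℂ) (y : Y) :
    kmul k a y = a.sum fun y' c => c * k y y' := by
  simp [kmul, Finsupp.linearCombination_apply, Finsupp.sum]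

theorem pair_kmul_symm {k : Y → Y → ℂ} (hk : ∀ y y', star (k y y') = k y' y)
    (a b : Y →₀ ℂ) : pair b (kmul k a) = star (pair a (kmul k b)) := by
  simp only [pair_eq, kmul_apply, Finsupp.sum, Finset.mul_sum, star_sum, star_mul', star_star, hk]
  rw [Finset.sum_comm]
  refine Finset.sum_congr rfl fun x _ => Finset.sum_congr rfl fun y _ => ?_
  ring

/-- Quadratic form in eigencoordinates. -/
theorem quad_eq_sum {n : Type*} [Fintype n] [DecidableEq n] {A : Matrix n n ℂ}
    (hA : A.IsHermitian) (x : n → ℂ) :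
    star x ⬝ᵥ (A *ᵥ x) =
      ∑ i, (hA.eigenvalues i : ℂ) * (‖star (hA.eigenvectorBasis i : n → ℂ) ⬝ᵥ x‖ ^ 2 : ℝ) := by
  have hb := hA.eigenvectorBasis.sum_repr (WithLp.toLp 2 x)
  have hx : x = ∑ i, (star (hA.eigenvectorBasis i : n → ℂ) ⬝ᵥ x) •
      (hA.eigenvectorBasis i : n → ℂ) := by
    have := congrArg (WithLp.ofLp) hb
    simp only [WithLp.ofLp_sum, WithLp.ofLp_smul] at this
    conv_lhs => rw [← this]
    refine Finset.sum_congr rfl fun i _ => ?_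
    rw [OrthonormalBasis.repr_apply_apply, EuclideanSpace.inner_eq_star_dotProduct, dotProduct_comm]
  set c : n → ℂ := fun i => star (hA.eigenvectorBasis i : n → ℂ) ⬝ᵥ x with hc
  have hAx : A *ᵥ x = ∑ i, (c i * hA.eigenvalues i) • (hA.eigenvectorBasis i : n → ℂ) := by
    conv_lhs => rw [hx]
    rw [Matrix.mulVec_sum]
    refine Finset.sum_congr rfl fun i _ => ?_
    rw [Matrix.mulVec_smul, hA.mulVec_eigenvectorBasis, mul_smul]
    rfl
  rw [hAx, dotProduct_sum]
  refine Finset.sum_congr rfl fun i _ => ?_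
  rw [dotProduct_smul]
  have : star x ⬝ᵥ (hA.eigenvectorBasis i : n → ℂ) = star (c i) := by
    rw [hc]; exact Matrix.star_dotProduct _ _
  rw [this, smul_eq_mul]
  have h2 : c i * star (c i) = ((‖c i‖ ^ 2 : ℝ) : ℂ) := by
    have := Complex.mul_conj' (c i)
    simpa using this
  linear_combination (hA.eigenvalues i : ℂ) * h2

/-- A family which is orthogonal and negative for a Hermitian matrix has at most as many members as
the matrix has negative eigenvalues. -/
theorem card_le_negEigenvalueCount {n ι : Type*} [Fintype n] [DecidableEq n] [Fintype ι]
    {A : Matrix n n ℂ} (hA : A.IsHermitian) (e : ι → n → ℂ)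
    (hoff : ∀ i j, i ≠ j → star (e i) ⬝ᵥ (A *ᵥ e j) = 0)
    (hneg : ∀ i, (star (e i) ⬝ᵥ (A *ᵥ e i)).re < 0) :
    Fintype.card ι ≤ negEigenvalueCount hA := by
  classical
  let S : (ι → ℂ) →ₗ[ℂ] (n → ℂ) := ∑ i, (LinearMap.proj i).smulRight (e i)
  have hS : ∀ c, S c = ∑ i, c i • e i := fun c => by simp [S]
  let L : (ι → ℂ) →ₗ[ℂ] ({i : n // hA.eigenvalues i < 0} → ℂ) :=
    (LinearMap.pi fun i => (dotProductBilin ℂ ℂ (star (hA.eigenvectorBasis i.1 : n → ℂ)))) ∘ₗ S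
  have hL : ∀ c i, L c i = star (hA.eigenvectorBasis i.1 : n → ℂ) ⬝ᵥ (S c) := fun c i => rfl
  have hinj : Function.Injective L := by
    rw [injective_iff_map_eq_zero]
    intro c hc
    have h1 : 0 ≤ (star (S c) ⬝ᵥ (A *ᵥ S c)).re := by
      rw [quad_eq_sum hA, Complex.re_sum]
      refine Finset.sum_nonneg fun i _ => ?_
      rw [← Complex.ofReal_mul, Complex.ofReal_re]
      by_cases hi : hA.eigenvalues i < 0
      · have := congrFun hc ⟨i, hi⟩
        rw [hL] at this
        simp [this]
      · exact mul_nonneg (not_lt.mp hi) (by positivity)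
    have h2 : (star (S c) ⬝ᵥ (A *ᵥ S c)).re =
        ∑ i, ‖c i‖ ^ 2 * (star (e i) ⬝ᵥ (A *ᵥ e i)).re := by
      have : star (S c) ⬝ᵥ (A *ᵥ S c) =
          ∑ i, ((‖c i‖ ^ 2 : ℝ) : ℂ) * (star (e i) ⬝ᵥ (A *ᵥ e i)) := by
        rw [hS, star_sum, Matrix.mulVec_sum, sum_dotProduct]
        refine Finset.sum_congr rfl fun i _ => ?_
        rw [dotProduct_sum, Finset.sum_eq_single i]
        · rw [star_smul, Matrix.mulVec_smul, smul_dotProduct, dotProduct_smul]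
          have h2 : c i * star (c i) = ((‖c i‖ ^ 2 : ℝ) : ℂ) := by
            have := Complex.mul_conj' (c i)
            simpa using this
          rw [← h2]; simp only [smul_eq_mul]; ring
        · intro j _ hj
          rw [star_smul, Matrix.mulVec_smul, smul_dotProduct, dotProduct_smul, hoff i j hj.symm]
          simp
        · simp
      rw [this, Complex.re_sum]
      simp [Complex.mul_re, -Complex.ofReal_pow]
    rw [h2] at h1
    have h3 : ∀ i ∈ Finset.univ, ‖c i‖ ^ 2 * (star (e i) ⬝ᵥ (A *ᵥ e i)).re ≤ 0 := fun i _ =>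
      mul_nonpos_of_nonneg_of_nonpos (by positivity) (hneg i).le
    have h4 := (Finset.sum_eq_zero_iff_of_nonpos h3).mp (le_antisymm (Finset.sum_nonpos h3) h1)
    funext i
    have h5 := h4 i (Finset.mem_univ i)
    rcases mul_eq_zero.mp h5 with h | h
    · simpa using h
    · exact absurd h (hneg i).ne
  have := LinearMap.finrank_le_finrank_of_injective hinj
  rwa [Module.finrank_fintype_fun_eq_card, Module.finrank_fintype_fun_eq_card,
    ← Nat.card_eq_fintype_card (α := {i : n // hA.eigenvalues i < 0})] at this

variable {X : Type*} {p : ℕ}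

/-- The scalar kernel on `X × Fin p` that corresponds to a matrix-valued kernel. -/
def flat (K : X → X → Matrix (Fin p) (Fin p) ℂ) (y y' : X × Fin p) : ℂ :=
  K y.1 y'.1 y.2 y'.2

theorem star_flat {K : X → X → Matrix (Fin p) (Fin p) ℂ} (hK : IsHermitianKernel K)
    (y y' : X × Fin p) : star (flat K y y') = flat K y' y := by
  have h := congrFun (congrFun (hK y.1 y'.1) y'.2) y.2
  simpa [flat] using h

/-- Finitely supported coefficients from a vector indexed like a block matrix. -/
noncomputable def push {M : ℕ} (w : Fin M → X) (v : Fin M × Fin p → ℂ) : X × Fin p →₀ ℂ :=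
  ∑ a, Finsupp.single (w a.1, a.2) (v a)

theorem pair_push_kmul (K : X → X → Matrix (Fin p) (Fin p) ℂ) {M : ℕ} (w : Fin M → X)
    (v v' : Fin M × Fin p → ℂ) :
    pair (push w v) (kmul (flat K) (push w v')) = star v ⬝ᵥ (gram K w *ᵥ v') := by
  simp only [push, pair_sum, map_sum, dotProduct, Matrix.mulVec]
  rw [Finset.sum_comm]
  refine Finset.sum_congr rfl fun a _ => ?_
  rw [Finset.mul_sum]
  refine Finset.sum_congr rfl fun b _ => ?_
  rw [pair_eq, Finsupp.sum_single_index (by simp), kmul_apply,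
    Finsupp.sum_single_index (by simp)]
  simp only [flat, gram, Matrix.of_apply, Pi.star_apply]
  ring

theorem exists_push {ι : Type*} [Fintype ι] (e : ι → X × Fin p →₀ ℂ) :
    ∃ (M : ℕ) (w : Fin M → X) (v : ι → Fin M × Fin p → ℂ), ∀ i, push w (v i) = e i := by
  classical
  let s : Finset X := Finset.univ.biUnion fun i => (e i).support.image Prod.fst
  let w : Fin s.card → X := fun m => (s.equivFin.symm m : X)
  refine ⟨s.card, w, fun i a => e i (w a.1, a.2), fun i => ?_⟩
  have hw : Function.Injective fun a : Fin s.card × Fin p => (w a.1, a.2) := by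
    rintro ⟨a, a'⟩ ⟨b, b'⟩ h
    simp only [Prod.mk.injEq] at h
    have := s.equivFin.symm.injective (Subtype.ext h.1)
    simp [this, h.2]
  ext ⟨x, j⟩
  simp only [push, Finsupp.finsetSum_apply]
  by_cases hx : x ∈ s
  · have h1 : w (s.equivFin ⟨x, hx⟩) = x := by simp [w]
    rw [Finset.sum_eq_single (s.equivFin ⟨x, hx⟩, j)]
    · simp [h1]
    · intro b _ hb
      rw [Finsupp.single_apply, if_neg]
      intro h
      apply hb
      apply hw
      simp [h, h1]
    · simp
  · rw [Finset.sum_eq_zero]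
    · symm
      by_contra h
      apply hx
      simp only [s, Finset.mem_biUnion, Finset.mem_univ, true_and, Finset.mem_image]
      exact ⟨i, (x, j), by simpa using h, rfl⟩
    · intro b _
      rw [Finsupp.single_apply, if_neg]
      intro h
      apply hx
      rw [← (Prod.mk.inj h).1]
      exact (s.equivFin.symm b.1).2

/-- A maximal family that is orthonormal for the opposite form. -/
theorem exists_negative_family {K : X → X → Matrix (Fin p) (Fin p) ℂ} {κ : ℕ}
    (hK : HasNegativeSquares K κ) :
    ∃ (ι : Type) (_ : Fintype ι) (_ : DecidableEq ι) (e : ι → X × Fin p →₀ ℂ),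
      (∀ i j, pair (e i) (kmul (flat K) (e j)) = if i = j then -1 else 0) ∧
      ∀ a, (∀ i, pair (e i) (kmul (flat K) a) = 0) → 0 ≤ (pair a (kmul (flat K) a)).re := by
  classical
  obtain ⟨hH, hle, M, w, hw⟩ := hK
  set hA := hH.gram w
  refine ⟨{i // hA.eigenvalues i < 0}, inferInstance, inferInstance,
    fun i => push w ((((Real.sqrt (-hA.eigenvalues i.1))⁻¹ : ℝ) : ℂ) •
      (hA.eigenvectorBasis i.1 : Fin M × Fin p → ℂ)), ?_⟩
  have horth : ∀ i j : {i // hA.eigenvalues i < 0}, pair (push w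
      ((((Real.sqrt (-hA.eigenvalues i.1))⁻¹ : ℝ) : ℂ) •
      (hA.eigenvectorBasis i.1 : Fin M × Fin p → ℂ))) (kmul (flat K) (push w
      ((((Real.sqrt (-hA.eigenvalues j.1))⁻¹ : ℝ) : ℂ) •
      (hA.eigenvectorBasis j.1 : Fin M × Fin p → ℂ)))) = if i = j then -1 else 0 := by
    intro i j
    rw [pair_push_kmul, Matrix.mulVec_smul, hA.mulVec_eigenvectorBasis, star_smul,
      smul_dotProduct, dotProduct_smul, dotProduct_smul]
    have h := orthonormal_iff_ite.mp hA.eigenvectorBasis.orthonormal i.1 j.1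
    rw [EuclideanSpace.inner_eq_star_dotProduct, dotProduct_comm] at h
    rw [h]
    by_cases hij : i = j
    · subst hij
      have hpos : 0 < -hA.eigenvalues i.1 := by have := i.2; linarith
      have hs := Real.mul_self_sqrt hpos.le
      have hs' : Real.sqrt (-hA.eigenvalues i.1) ≠ 0 := (Real.sqrt_pos.mpr hpos).ne'
      simp only [if_true, smul_eq_mul, mul_one, Complex.star_def, Complex.conj_ofReal,
        Complex.real_smul]
      rw [show hA.eigenvalues i.1 = -(Real.sqrt (-hA.eigenvalues i.1) *
        Real.sqrt (-hA.eigenvalues i.1)) by rw [hs]; ring]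
      rw [hs]
      push_cast
      have hs2 : ((Real.sqrt (-hA.eigenvalues i.1) : ℝ) : ℂ) ≠ 0 := by exact_mod_cast hs'
      have hs3 : ((Real.sqrt (-hA.eigenvalues i.1) : ℝ) : ℂ) *
        ((Real.sqrt (-hA.eigenvalues i.1) : ℝ) : ℂ) = -(hA.eigenvalues i.1 : ℂ) := by
        exact_mod_cast hs
      simp only [neg_neg]
      field_simp
      linear_combination hs3
    · have : (i : Fin M × Fin p) ≠ j := fun h => hij (Subtype.ext h)
      simp [hij, this]
  refine ⟨horth, fun a ha => ?_⟩
  by_contra hneg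
  rw [not_le] at hneg
  set e : {i // hA.eigenvalues i < 0} → X × Fin p →₀ ℂ :=
    fun i => push w ((((Real.sqrt (-hA.eigenvalues i.1))⁻¹ : ℝ) : ℂ) •
      (hA.eigenvectorBasis i.1 : Fin M × Fin p → ℂ)) with he
  obtain ⟨M', w', v, hv⟩ := exists_push (fun o : Option {i // hA.eigenvalues i < 0} => o.elim a e)
  have hcard := card_le_negEigenvalueCount (hH.gram w') v (by
      intro i j hij
      rw [← pair_push_kmul, hv, hv]
      rcases i with _ | i <;> rcases j with _ | j
      · exact absurd rfl hij
      · change pair a (kmul (flat K) (e j)) = 0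
        rw [pair_kmul_symm (star_flat hH), ha j, star_zero]
      · exact ha i
      · change pair (e i) (kmul (flat K) (e j)) = 0
        rw [horth, if_neg]
        rintro rfl
        exact hij rfl) (by
      intro i
      rw [← pair_push_kmul, hv]
      rcases i with _ | i
      · exact hneg
      · change (pair (e i) (kmul (flat K) (e i))).re < 0
        rw [horth]
        simp)
  have h1 := hle M' w'
  rw [Fintype.card_option, ← Nat.card_eq_fintype_card] at hcard
  have h2 : Nat.card {i // hA.eigenvalues i < 0} = κ := hw
  omega


/-- The part of the kernel that is nonnegative. -/
noncomputable def kplus (K : X → X → Matrix (Fin p) (Fin p) ℂ) {ι : Type} [Fintype ι]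
    (e : ι → X × Fin p →₀ ℂ) (y y' : X × Fin p) : ℂ :=
  flat K y y' + ∑ l, kmul (flat K) (e l) y * star (kmul (flat K) (e l) y')

theorem kmul_kplus (K : X → X → Matrix (Fin p) (Fin p) ℂ) {ι : Type} [Fintype ι]
    (e : ι → X × Fin p →₀ ℂ) (a : X × Fin p →₀ ℂ) (y : X × Fin p) :
    kmul (kplus K e) a y = kmul (flat K) a y +
      ∑ l, kmul (flat K) (e l) y * star (pair a (kmul (flat K) (e l))) := by
  rw [kmul_apply, kmul_apply]
  simp only [kplus, pair_eq, Finsupp.sum, mul_add, Finset.sum_add_distrib, Finset.mul_sum,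
    star_sum, star_mul', star_star]
  congr 1
  rw [Finset.sum_comm]
  refine Finset.sum_congr rfl fun l _ => Finset.sum_congr rfl fun y' _ => ?_
  ring

theorem kplus_nonneg {K : X → X → Matrix (Fin p) (Fin p) ℂ} (hH : IsHermitianKernel K)
    {ι : Type} [Fintype ι] [DecidableEq ι] {e : ι → X × Fin p →₀ ℂ}
    (he : ∀ i j, pair (e i) (kmul (flat K) (e j)) = if i = j then -1 else 0)
    (hmax : ∀ a, (∀ i, pair (e i) (kmul (flat K) a) = 0) → 0 ≤ (pair a (kmul (flat K) a)).re)
    (a : X × Fin p →₀ ℂ) : 0 ≤ (pair a (kmul (kplus K e) a)).re := by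
  set c : ι → ℂ := fun l => pair (e l) (kmul (flat K) a) with hc
  have hcs : ∀ l, pair a (kmul (flat K) (e l)) = star (c l) := fun l =>
    pair_kmul_symm (star_flat hH) _ _
  have h0 : ∀ i, pair (e i) (kmul (flat K) (a + ∑ l, c l • e l)) = 0 := by
    intro i
    simp only [map_add, map_sum, map_smul, he, smul_eq_mul]
    simp [hc]
  have h := hmax _ h0
  have e1 : pair (a + ∑ l, c l • e l) (kmul (flat K) (a + ∑ l, c l • e l)) =
      pair a (kmul (kplus K e) a) := by
    rw [pair_add, pair_sum]
    simp only [pair_smul, h0, mul_zero, Finset.sum_const_zero, add_zero]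
    have : kmul (kplus K e) a = kmul (flat K) (a + ∑ l, c l • e l) := by
      funext y
      rw [kmul_kplus]
      simp only [map_add, map_sum, map_smul, Pi.add_apply, Finset.sum_apply, Pi.smul_apply,
        smul_eq_mul, hcs, star_star]
      congr 1
      exact Finset.sum_congr rfl fun l _ => mul_comm _ _
    rw [this]
  rwa [e1] at h

/-- The nonnegative part as an operator-valued matrix. -/
noncomputable def kplusMat (K : X → X → Matrix (Fin p) (Fin p) ℂ) {ι : Type} [Fintype ι]
    (e : ι → X × Fin p →₀ ℂ) : Matrix (X × Fin p) (X × Fin p) (ℂ →L[ℂ] ℂ) :=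
  Matrix.of fun y y' => kplus K e y y' • ContinuousLinearMap.id ℂ ℂ

theorem star_kplus {K : X → X → Matrix (Fin p) (Fin p) ℂ} (hH : IsHermitianKernel K)
    {ι : Type} [Fintype ι] (e : ι → X × Fin p →₀ ℂ) (y y' : X × Fin p) :
    star (kplus K e y y') = kplus K e y' y := by
  simp only [kplus, star_add, star_flat hH, star_sum, star_mul', star_star]
  congr 1
  exact Finset.sum_congr rfl fun l _ => mul_comm _ _

theorem kplusMat_posSemidef {K : X → X → Matrix (Fin p) (Fin p) ℂ} (hH : IsHermitianKernel K)
    {ι : Type} [Fintype ι] [DecidableEq ι] {e : ι → X × Fin p →₀ ℂ}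
    (he : ∀ i j, pair (e i) (kmul (flat K) (e j)) = if i = j then -1 else 0)
    (hmax : ∀ a, (∀ i, pair (e i) (kmul (flat K) a) = 0) → 0 ≤ (pair a (kmul (flat K) a)).re) :
    (kplusMat K e).PosSemidef := by
  have h02 : (kplusMat K e).PosSemidef ↔ (kplusMat K e).IsHermitian ∧ ∀ (a : X × Fin p →₀ ℂ),
      0 ≤ RCLike.re (a.sum fun x w => a.sum fun x' w' => inner ℂ (kplusMat K e x' x w) w') :=
    (RKHS.posSemidef_tfae (K := kplusMat K e)).out 0 2
  refine h02.mpr ⟨?_, fun a => ?_⟩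
  · ext y y'
    refine ext_inner_left ℂ fun w => ?_
    rw [Matrix.conjTranspose_apply, ContinuousLinearMap.star_eq_adjoint,
      ContinuousLinearMap.adjoint_inner_right]
    have := star_kplus hH e y' y
    simp only [Complex.star_def] at this
    simp [kplusMat, ← this]
  · have h := kplus_nonneg hH he hmax a
    have key : (a.sum fun x w => a.sum fun x' w' => inner ℂ (kplusMat K e x' x w) w') =
        star (pair a (kmul (kplus K e) a)) := by
      simp only [pair_eq, kmul_apply, Finsupp.sum, star_sum, Finset.mul_sum, star_mul', star_star]
      rw [Finset.sum_comm]
      refine Finset.sum_congr rfl fun y _ => Finset.sum_congr rfl fun y' _ => ?_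
      simp only [kplusMat, Matrix.of_apply, _root_.smul_apply,
        ContinuousLinearMap.id_apply, smul_eq_mul, RCLike.inner_apply, map_mul, Complex.star_def]
      ring
    rw [key, Complex.star_def]
    simpa using h

/-- The sum of the reproducing kernel Hilbert space of the nonnegative part and of the span of
finitely many functions is a reproducing kernel Pontryagin space. -/
theorem exists_hasKernel_aux {K : X → X → Matrix (Fin p) (Fin p) ℂ}
    {ι : Type} [Fintype ι] [DecidableEq ι] {e : ι → X × Fin p →₀ ℂ}
    (he : ∀ i j, pair (e i) (kmul (flat K) (e j)) = if i = j then -1 else 0)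
    {H : Type*} [NormedAddCommGroup H] [InnerProductSpace ℂ H] [CompleteSpace H]
    [RKHS ℂ H (X × Fin p) ℂ] (ker : X × Fin p → H)
    (hker : ∀ y y', ker y y' = kplus K e y' y)
    (hrep : ∀ y (h : H), inner ℂ (ker y) h = h y) :
    ∃ P : PontryaginFunctionSpace X p, P.HasKernel K := by
  let u : ι → X × Fin p → ℂ := fun l => kmul (flat K) (e l)
  let J : H × (ι → ℂ) →ₗ[ℂ] (X → Fin p → ℂ) :=
    { toFun := fun a x i => a.1 (x, i) + ∑ l, a.2 l * u l (x, i)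
      map_add' := by
        intro a b
        funext x i
        simp only [Prod.fst_add, Prod.snd_add, RKHS.coe_add, Pi.add_apply, add_mul,
          Finset.sum_add_distrib]
        ring
      map_smul' := by
        intro c a
        funext x i
        simp only [Prod.smul_fst, Prod.smul_snd, RKHS.coe_smul, Pi.smul_apply, smul_eq_mul,
          RingHom.id_apply, mul_add, Finset.mul_sum, mul_assoc] }
  have hJ : ∀ a x i, J a x i = a.1 (x, i) + ∑ l, a.2 l * u l (x, i) := fun _ _ _ => rfl
  have hzero : ∀ (m : ι) (h : H), pair (e m) (fun y => h y) = 0 := by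
    intro m h
    have h1 : pair (e m) (fun y => h y) = inner ℂ (∑ y ∈ (e m).support, e m y • ker y) h := by
      rw [pair_eq, Finsupp.sum, sum_inner]
      refine Finset.sum_congr rfl fun y _ => ?_
      rw [inner_smul_left, hrep]
      rfl
    have h2 : ∑ y ∈ (e m).support, e m y • ker y = 0 := by
      have h4 : ∀ y', (∑ y ∈ (e m).support, e m y • ker y) y' = kmul (kplus K e) (e m) y' := by
        intro y'
        rw [kmul_apply, Finsupp.sum]
        have : ∀ s : Finset (X × Fin p), (∑ y ∈ s, e m y • ker y) y' =
            ∑ y ∈ s, e m y * kplus K e y' y := by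
          intro s
          classical
          induction s using Finset.induction_on with
          | empty => simp
          | insert y s hy ih =>
            rw [Finset.sum_insert hy, Finset.sum_insert hy, RKHS.coe_add, Pi.add_apply, ih,
              RKHS.coe_smul, Pi.smul_apply, hker, smul_eq_mul]
        exact this _
      refine RKHS.ext fun y' => ?_
      rw [h4, kmul_kplus]
      simp [he, apply_ite (starRingEnd ℂ)]
    rw [h1, h2, inner_zero_left]
  have hJinj : Function.Injective J := by
    rw [injective_iff_map_eq_zero]
    rintro ⟨h, c⟩ ha
    have h1 : (fun y => h y) + ∑ l, c l • u l = 0 := by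
      funext y
      have := congrFun (congrFun ha y.1) y.2
      simpa [hJ] using this
    have hc : c = 0 := by
      funext m
      have h2 := congrArg (pair (e m)) h1
      simp only [map_add, hzero, map_sum, map_smul, u, he, map_zero, zero_add, smul_eq_mul] at h2
      simpa using h2
    subst hc
    have hh : h = 0 := by
      refine RKHS.ext fun y => ?_
      have := congrFun h1 y
      simpa using this
    rw [hh]
    rfl
  let E := LinearEquiv.ofInjective J hJinj
  have hE : ∀ f : LinearMap.range J, J (E.symm f) = f := by
    intro f
    exact congrArg Subtype.val (E.apply_symm_apply f)
  let B : LinearMap.range J →ₗ[ℂ] LinearMap.range J →ₗ⋆[ℂ] ℂ :=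
    LinearMap.mk₂'ₛₗ (RingHom.id ℂ) (starRingEnd ℂ)
      (fun f g => inner ℂ (E.symm g).1 (E.symm f).1 -
        ∑ l, (E.symm f).2 l * star ((E.symm g).2 l))
      (by intro f f' g; simp [add_mul, Finset.sum_add_distrib]; ring)
      (by intro c f g; simp [Finset.mul_sum, mul_sub, mul_assoc])
      (by intro f g g'; simp [mul_add, Finset.sum_add_distrib]; ring)
      (by
        intro c f g
        simp only [map_smul, Prod.smul_fst, Prod.smul_snd, inner_smul_left, Pi.smul_apply,
          smul_eq_mul, star_mul', Finset.mul_sum, mul_sub]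
        congr 1
        refine Finset.sum_congr rfl fun l _ => ?_
        rw [Complex.star_def]
        ring)
  have hB : ∀ f g, B f g = inner ℂ (E.symm g).1 (E.symm f).1 -
        ∑ l, (E.symm f).2 l * star ((E.symm g).2 l) := fun _ _ => rfl
  let p1 : LinearMap.range J →ₗ[ℂ] H := LinearMap.fst ℂ H (ι → ℂ) ∘ₗ E.symm.toLinearMap
  let p2 : LinearMap.range J →ₗ[ℂ] (ι → ℂ) := LinearMap.snd ℂ H (ι → ℂ) ∘ₗ E.symm.toLinearMap
  have hp1 : ∀ f, p1 f = (E.symm f).1 := fun _ => rfl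
  have hp2 : ∀ f, p2 f = (E.symm f).2 := fun _ => rfl
  have hre : ∀ f ∈ LinearMap.ker p2, (B f f).re = ‖p1 f‖ ^ 2 := by
    intro f hf
    rw [LinearMap.mem_ker, hp2] at hf
    rw [hB, hf, hp1]
    simp [← inner_self_eq_norm_sq (𝕜 := ℂ)]
  have hext : ∀ f, p1 f = 0 → p2 f = 0 → f = 0 := by
    intro f h1 h2
    apply E.symm.injective
    rw [map_zero]
    exact Prod.ext h1 h2
  have hPont : IsPontryagin B := by
    refine ⟨fun f g => ?_, LinearMap.ker p2, LinearMap.ker p1, ?_, ?_, ⟨?_, ?_⟩, ?_, ?_⟩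
    · rw [hB, hB, star_sub, star_sum]
      congr 1
      · rw [Complex.star_def, inner_conj_symm]
      · refine Finset.sum_congr rfl fun l _ => ?_
        rw [star_mul', star_star, mul_comm]
    · constructor
      · rw [Submodule.disjoint_def]
        intro f h2 h1
        exact hext f h1 h2
      · rw [codisjoint_iff, eq_top_iff]
        intro f _
        rw [Submodule.mem_sup]
        refine ⟨E ((E.symm f).1, 0), ?_, E (0, (E.symm f).2), ?_, ?_⟩
        · rw [LinearMap.mem_ker, hp2, E.symm_apply_apply]
        · rw [LinearMap.mem_ker, hp1, E.symm_apply_apply]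
        · rw [← map_add]
          apply E.symm.injective
          rw [E.symm_apply_apply]
          ext <;> simp
    · intro f hf g hg
      rw [LinearMap.mem_ker, hp2] at hf
      rw [LinearMap.mem_ker, hp1] at hg
      rw [hB, hf, hg]
      simp
    · intro f hf hne
      rw [hre f hf]
      have : p1 f ≠ 0 := fun h => hne (hext f h hf)
      positivity
    · intro v hv hcau
      have hc : CauchySeq fun n => p1 (v n) := by
        rw [Metric.cauchySeq_iff]
        intro ε hε
        obtain ⟨n₀, h⟩ := hcau (ε ^ 2) (by positivity)
        refine ⟨n₀, fun m hm n hn => ?_⟩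
        have := h m hm n hn
        rw [hre _ (Submodule.sub_mem _ (hv m) (hv n)), map_sub] at this
        rw [dist_eq_norm]
        exact lt_of_pow_lt_pow_left₀ 2 hε.le this
      obtain ⟨h, hh⟩ := cauchySeq_tendsto_of_complete hc
      have hm : E (h, 0) ∈ LinearMap.ker p2 := by
        rw [LinearMap.mem_ker, hp2, E.symm_apply_apply]
      refine ⟨E (h, 0), hm, ?_⟩
      have h3 : ∀ n, (B (v n - E (h, 0)) (v n - E (h, 0))).re = ‖p1 (v n) - h‖ ^ 2 := by
        intro n
        rw [hre _ (Submodule.sub_mem _ (hv n) hm), map_sub, hp1 (E (h, 0)), E.symm_apply_apply]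
      simp only [h3]
      have := (tendsto_iff_norm_sub_tendsto_zero.mp hh).pow 2
      simpa using this
    · refine Module.Finite.of_injective (p2 ∘ₗ (LinearMap.ker p1).subtype) ?_
      rw [injective_iff_map_eq_zero]
      intro f hf
      exact Subtype.ext (hext f.1 f.2 hf)
    · intro f hf hne
      have h2 : p2 f ≠ 0 := fun h => hne (hext f hf h)
      rw [LinearMap.mem_ker, hp1] at hf
      rw [hB, hf, inner_zero_left, zero_sub, ← hp2]
      obtain ⟨l, hl⟩ := Function.ne_iff.mp h2
      have h5 : ∑ l, p2 f l * star (p2 f l) = ((∑ l, ‖p2 f l‖ ^ 2 : ℝ) : ℂ) := by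
        push_cast
        exact Finset.sum_congr rfl fun l _ => Complex.mul_conj' _
      rw [h5, Complex.neg_re, Complex.ofReal_re, neg_lt_zero]
      refine Finset.sum_pos' (fun i _ => by positivity) ⟨l, Finset.mem_univ l, ?_⟩
      have : p2 f l ≠ 0 := hl
      positivity
  refine ⟨⟨LinearMap.range J, B, hPont⟩, fun w ξ => ?_⟩
  have hfun : J (∑ j, ξ j • ker (w, j), fun l => -∑ j, ξ j * star (u l (w, j))) =
      fun z => K z w *ᵥ ξ := by
    funext z i
    have h6 : (∑ j, ξ j • ker (w, j)) (z, i) = ∑ j, ξ j * kplus K e (z, i) (w, j) := by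
      have : ∀ s : Finset (Fin p), (∑ j ∈ s, ξ j • ker (w, j)) (z, i) =
          ∑ j ∈ s, ξ j * kplus K e (z, i) (w, j) := by
        intro s
        induction s using Finset.induction_on with
        | empty => simp
        | insert y s hy ih =>
          rw [Finset.sum_insert hy, Finset.sum_insert hy, RKHS.coe_add, Pi.add_apply, ih,
            RKHS.coe_smul, Pi.smul_apply, hker, smul_eq_mul]
      exact this _
    rw [hJ, h6]
    simp only [kplus, mul_add, Finset.sum_add_distrib, Finset.mul_sum, neg_mul, Finset.sum_mul,
      Finset.sum_neg_distrib, Matrix.mulVec, dotProduct]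
    rw [Finset.sum_comm (s := (Finset.univ : Finset (Fin p))) (t := (Finset.univ : Finset ι))]
    rw [add_assoc, ← sub_eq_add_neg, ← Finset.sum_sub_distrib, Finset.sum_eq_zero (s := (Finset.univ : Finset ι)), add_zero]
    · exact Finset.sum_congr rfl fun j _ => mul_comm _ _
    · intro l _
      rw [← Finset.sum_sub_distrib]
      refine Finset.sum_eq_zero fun j _ => ?_
      simp only [u]
      ring
  have hmem : (fun z => K z w *ᵥ ξ) ∈ LinearMap.range J := ⟨_, hfun⟩
  refine ⟨hmem, fun f => ?_⟩
  have hsymm : E.symm ⟨fun z => K z w *ᵥ ξ, hmem⟩ =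
      (∑ j, ξ j • ker (w, j), fun l => -∑ j, ξ j * star (u l (w, j))) := by
    rw [LinearEquiv.symm_apply_eq]
    exact Subtype.ext hfun.symm
  change B f ⟨_, hmem⟩ = _
  rw [hB, hsymm, ← hE f]
  simp only [sum_inner, inner_smul_left, hrep, dotProduct, hJ, Pi.star_apply, mul_add,
    Finset.sum_add_distrib, star_neg, star_sum, star_mul', star_star, mul_neg,
    Finset.sum_neg_distrib, sub_neg_eq_add, Finset.mul_sum]
  congr 1
  rw [Finset.sum_comm]
  refine Finset.sum_congr rfl fun j _ => Finset.sum_congr rfl fun l _ => ?_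
  ring

/-- For every kernel with finitely many negative squares the reproducing kernel Pontryagin space
exists. -/
theorem exists_hasKernel {K : X → X → Matrix (Fin p) (Fin p) ℂ} {κ : ℕ}
    (hK : HasNegativeSquares K κ) : ∃ P : PontryaginFunctionSpace X p, P.HasKernel K := by
  obtain ⟨ι, _, _, e, he, hmax⟩ := exists_negative_family hK
  have hH := hK.1
  have hfact : Fact (kplusMat K e).PosSemidef := ⟨kplusMat_posSemidef hH he hmax⟩
  refine exists_hasKernel_aux (H := RKHS.OfKernel (kplusMat K e)) he
    (fun y => RKHS.kerFun (RKHS.OfKernel (kplusMat K e)) y (1 : ℂ)) (fun y y' => ?_)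
    (fun y h => ?_)
  · rw [RKHS.kerFun_apply, RKHS.OfKernel.kernel_ofKernel]
    simp [kplusMat]
  · rw [RKHS.kerFun_inner]
    simp

end Existence

/-! ### The map `φ(z) = z^N` -/

/-- The map `φ(z) = z^N` on a set `Ω` of complex numbers that it maps into itself. -/
def powMap {Ω : Set ℂ} {N : ℕ} (hΩ : ∀ z ∈ Ω, z ^ N ∈ Ω) (z : Ω) : Ω :=
  ⟨(z : ℂ) ^ N, hΩ z z.2⟩

end PontryaginKernel

namespace PontryaginKernel

/-! It is not known beforehand that `∑ n, m n z *ᵥ f n (φ z)` lies in the space of `Kt`, so the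
argument starts from the adjoint. If the operator exists, its adjoint must send `Kt(·, w) ξ` to the
tuple with entries `K(·, φ w) (m n w)ᴴ ξ`. This formula prescribes a map on coefficients of linear
combinations of kernel functions (`pullback`), and positivity of the difference kernel says exactly
that the map does not increase the inner square. It is thus a contraction from a dense subspace of
`𝒫(Kt)` into `𝒫(K)^N`.

In Hilbert spaces such a map would extend at once. For indefinite forms the equality of negative
indices is needed: `𝒫(Kt)` and `𝒫(K)^N` both have index `N * κ`. A maximal negative family of
`𝒫(Kt)` is sent to a negative family of the same size, hence to a maximal one, and the form is
nonnegative on its orthogonal complement. Splitting along this family bounds the map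
(`DenseContraction.exists_norm_le`). It therefore extends continuously, and a second count of
negative dimensions shows that the adjoint of the extension is again a contraction
(`DenseContraction.exists_adjoint_pair`).

That adjoint is the required operator: pairing its values with `Kt(·, z) ξ` and moving the operator
across the form gives the pointwise formula. To have norms available, each Pontryagin space is
replaced by a Hilbert space with an isometric involution `J` and form `⟨x, J y⟩`
(`IsPontryagin.exists_krein_model`). -/

/-- If the quadratic quantity `Q` is nonnegative on the common kernel of `ι'`-many functionals, a
linear family with more than `ι'` parameters meets the set where `Q` is nonnegative. -/
theorem exists_ne_zero_nonneg {V ι ι' : Type*} [AddCommGroup V] [Module ℂ V] [Fintype ι]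
    [Fintype ι'] (hcard : Fintype.card ι' < Fintype.card ι) (φ : ι' → V →ₗ[ℂ] ℂ) (Q : V → ℝ)
    (hQ : ∀ x, (∀ i, φ i x = 0) → 0 ≤ Q x) (Ψ : (ι → ℂ) →ₗ[ℂ] V) : ∃ c ≠ 0, 0 ≤ Q (Ψ c) := by
  have h : LinearMap.ker ((LinearMap.pi φ) ∘ₗ Ψ) ≠ ⊥ := by
    apply LinearMap.ker_ne_bot_of_finrank_lt
    simpa [Module.finrank_fintype_fun_eq_card] using hcard
  obtain ⟨c, hc, hne⟩ := Submodule.exists_mem_ne_zero_of_ne_bot h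
  exact ⟨c, hne, hQ _ fun i => congrFun (LinearMap.mem_ker.mp hc) i⟩

/-! ### Densely defined contractions between Hilbert spaces with an indefinite form `⟨x, J y⟩`. -/

section Krein

variable {E E₁ E₂ A ι ι' : Type*} [NormedAddCommGroup E] [InnerProductSpace ℂ E]
  [NormedAddCommGroup E₁] [InnerProductSpace ℂ E₁]
  [NormedAddCommGroup E₂] [InnerProductSpace ℂ E₂]
  [AddCommGroup A] [Module ℂ A] [Fintype ι] [Fintype ι']

theorem inner_symmetry_left {J : E ≃ₗᵢ[ℂ] E} (hJ : ∀ x, J (J x) = x) (x y : E) :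
    inner ℂ (J x) y = inner ℂ x (J y) := by
  rw [← J.inner_map_map x (J y), hJ]

theorem re_krein_comm {J : E ≃ₗᵢ[ℂ] E} (hJ : ∀ x, J (J x) = x) (x y : E) :
    (inner ℂ x (J y)).re = (inner ℂ y (J x)).re := by
  rw [← inner_symmetry_left hJ, ← inner_conj_symm, Complex.conj_re]

theorem re_krein_add {J : E ≃ₗᵢ[ℂ] E} (hJ : ∀ x, J (J x) = x) (x y : E) :
    (inner ℂ (x + y) (J (x + y))).re =
      (inner ℂ x (J x)).re + 2 * (inner ℂ x (J y)).re + (inner ℂ y (J y)).re := by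
  simp only [map_add, inner_add_left, inner_add_right, Complex.add_re]
  rw [re_krein_comm hJ y x]
  ring

theorem re_krein_smul (J : E ≃ₗᵢ[ℂ] E) (c : ℂ) (x : E) :
    (inner ℂ (c • x) (J (c • x))).re = ‖c‖ ^ 2 * (inner ℂ x (J x)).re := by
  rw [map_smul, inner_smul_left, inner_smul_right, ← mul_assoc, Complex.conj_mul',
    ← Complex.ofReal_pow, Complex.re_ofReal_mul]

theorem re_krein_le (J : E ≃ₗᵢ[ℂ] E) (x : E) : (inner ℂ x (J x)).re ≤ ‖x‖ ^ 2 := by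
  refine (Complex.re_le_norm _).trans ((norm_inner_le_norm _ _).trans ?_)
  rw [J.norm_map, sq]

/-- The combination of a finite family with given coefficients. -/
noncomputable def combine (e : ι → A) : (ι → ℂ) →ₗ[ℂ] A := Fintype.linearCombination ℂ e

theorem combine_apply (e : ι → A) (c : ι → ℂ) : combine e c = ∑ i, c i • e i :=
  Fintype.linearCombination_apply _ _ _

theorem krein_combine [DecidableEq ι] (J : E₁ ≃ₗᵢ[ℂ] E₁) (α : A →ₗ[ℂ] E₁) {e : ι → A}
    (he : ∀ i j, inner ℂ (α (e i)) (J (α (e j))) = if i = j then -1 else 0) (c : ι → ℂ) :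
    (inner ℂ (α (combine e c)) (J (α (combine e c)))).re = -∑ i, ‖c i‖ ^ 2 := by
  simp only [combine_apply, map_sum, map_smul, sum_inner, inner_sum, inner_smul_left,
    inner_smul_right, he]
  simp only [mul_ite, mul_neg, mul_one, mul_zero, Finset.sum_ite_eq', Finset.mem_univ, if_true,
    Complex.re_sum]
  rw [← Finset.sum_neg_distrib]
  refine Finset.sum_congr rfl fun i _ => ?_
  rw [Complex.neg_re, Complex.mul_conj', ← Complex.ofReal_pow, Complex.ofReal_re]

theorem sum_norm_sq_pos {c : ι → ℂ} (hc : c ≠ 0) : 0 < ∑ i, ‖c i‖ ^ 2 := by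
  obtain ⟨i, hi⟩ := Function.ne_iff.mp hc
  have : 0 < ‖c i‖ := norm_pos_iff.mpr hi
  exact Finset.sum_pos' (fun _ _ => by positivity) ⟨i, Finset.mem_univ i, by positivity⟩

/-- The coefficient space `ι → ℂ` carries the sup norm, whereas the form on a normalised negative
family is minus the ℓ² sum. This comparison is what lets `-‖d‖ ^ 2` serve as an upper bound below.
-/
theorem norm_sq_le_sum (c : ι → ℂ) : ‖c‖ ^ 2 ≤ ∑ i, ‖c i‖ ^ 2 := by
  have h0 : 0 ≤ ∑ i, ‖c i‖ ^ 2 := Finset.sum_nonneg fun _ _ => by positivity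
  have : ‖c‖ ≤ √(∑ i, ‖c i‖ ^ 2) := (pi_norm_le_iff_of_nonneg (Real.sqrt_nonneg _)).mpr fun i =>
    Real.le_sqrt_of_sq_le (Finset.single_le_sum (f := fun i => ‖c i‖ ^ 2)
      (fun _ _ => by positivity) (Finset.mem_univ i))
  calc ‖c‖ ^ 2 ≤ √(∑ i, ‖c i‖ ^ 2) ^ 2 := by gcongr
    _ = _ := Real.sq_sqrt h0

/-- A linear combination of `ι`-many vectors and one further vector. -/
noncomputable def combineOption {σ : Type*} (Φ : (σ → ℂ) →ₗ[ℂ] A) (x : A) : (Option σ → ℂ) →ₗ[ℂ] A :=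
  Φ ∘ₗ LinearMap.funLeft ℂ ℂ some + (LinearMap.proj none).smulRight x

theorem combineOption_apply {σ : Type*} (Φ : (σ → ℂ) →ₗ[ℂ] A) (x : A) (c : Option σ → ℂ) :
    combineOption Φ x c = Φ (fun i => c (some i)) + c none • x := rfl

/-- The data of a contraction which is defined on a dense set and maps a negative family to a
maximal negative family. -/
structure DenseContraction (J₁ : E₁ ≃ₗᵢ[ℂ] E₁) (J₂ : E₂ ≃ₗᵢ[ℂ] E₂) (α : A →ₗ[ℂ] E₁)
    (β : A →ₗ[ℂ] E₂) [DecidableEq ι] (e : ι → A) (f : ι' → E₂) : Prop where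
  symm₁ : ∀ x, J₁ (J₁ x) = x
  symm₂ : ∀ x, J₂ (J₂ x) = x
  dense : DenseRange α
  le : ∀ a, (inner ℂ (β a) (J₂ (β a))).re ≤ (inner ℂ (α a) (J₁ (α a))).re
  neg : ∀ i j, inner ℂ (α (e i)) (J₁ (α (e j))) = if i = j then -1 else 0
  nonneg : ∀ x, (∀ i, inner ℂ (f i) (J₂ x) = 0) → 0 ≤ (inner ℂ x (J₂ x)).re
  card_le : Fintype.card ι' ≤ Fintype.card ι

namespace DenseContraction

variable {J₁ : E₁ ≃ₗᵢ[ℂ] E₁} {J₂ : E₂ ≃ₗᵢ[ℂ] E₂} {α : A →ₗ[ℂ] E₁} {β : A →ₗ[ℂ] E₂}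
  [DecidableEq ι] {e : ι → A} {f : ι' → E₂}

theorem card_lt (h : DenseContraction J₁ J₂ α β e f) :
    Fintype.card ι' < Fintype.card (Option ι) := by
  rw [Fintype.card_option]
  exact Nat.lt_succ_of_le h.card_le

/-- Since inner squares do not increase, the image of the negative family stays linearly independent
and spans a negative definite subspace of dimension `Fintype.card ι`. -/
theorem image_le (h : DenseContraction J₁ J₂ α β e f) (c : ι → ℂ) :
    (inner ℂ (β (combine e c)) (J₂ (β (combine e c)))).re ≤ -∑ i, ‖c i‖ ^ 2 :=
  (h.le _).trans_eq (krein_combine J₁ α h.neg c)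

/-- A negative `u` orthogonal to the image of the family would enlarge it to a negative definite
subspace of dimension `Fintype.card ι + 1`. This exceeds the number of functionals given by `f`, so
some nonzero element of the subspace is annihilated by all of them and has nonnegative inner square.
-/
theorem nonneg_of_orthogonal (h : DenseContraction J₁ J₂ α β e f) {u : E₂}
    (hu : ∀ c, inner ℂ (β (combine e c)) (J₂ u) = 0) : 0 ≤ (inner ℂ u (J₂ u)).re := by
  by_contra hneg
  rw [not_le] at hneg
  obtain ⟨c, hc, hQ⟩ := exists_ne_zero_nonneg h.card_lt
    (fun i => (innerₛₗ ℂ (f i)) ∘ₗ J₂.toLinearMap) (fun x => (inner ℂ x (J₂ x)).re)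
    (fun x hx => h.nonneg x hx) (combineOption (β ∘ₗ combine e) u)
  rw [combineOption_apply, re_krein_add h.symm₂, re_krein_smul, map_smul, inner_smul_right,
    LinearMap.comp_apply, hu, mul_zero, Complex.zero_re, mul_zero, add_zero] at hQ
  have h1 := h.image_le fun i => c (some i)
  by_cases h0 : c none = 0
  · have : (fun i => c (some i)) ≠ 0 := by
      intro h2
      apply hc
      funext o
      cases o with
      | none => exact h0
      | some i => exact congrFun h2 i
    have := sum_norm_sq_pos this
    rw [h0, norm_zero] at hQ
    linarith
  · have h2 : 0 < ‖c none‖ := norm_pos_iff.mpr h0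
    have h3 : 0 ≤ ∑ i, ‖c (some i)‖ ^ 2 := Finset.sum_nonneg fun _ _ => by positivity
    have := mul_neg_of_pos_of_neg (pow_pos h2 2) hneg
    linarith

/-- Projection along the negative family: coefficients of the component. -/
theorem exists_coeff (h : DenseContraction J₁ J₂ α β e f) :
    ∃ D : E₂ →L[ℂ] (ι → ℂ), ∀ y c, inner ℂ (β (combine e c)) (J₂ (y - β (combine e (D y)))) = 0 := by
  let P : E₂ →ₗ[ℂ] (ι → ℂ) := LinearMap.pi fun i => (innerₛₗ ℂ (β (e i))) ∘ₗ J₂.toLinearMap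
  have hP : ∀ y c, inner ℂ (β (combine e c)) (J₂ y) = ∑ i, star (c i) * P y i := by
    intro y c
    simp only [combine_apply, map_sum, map_smul, sum_inner, inner_smul_left]
    rfl
  -- The Gram map of the image family. It is injective because the form is negative definite on the
  -- span, and inverting it yields the coefficients of the orthogonal projection.
  let G : (ι → ℂ) →ₗ[ℂ] (ι → ℂ) := P ∘ₗ β ∘ₗ combine e
  have hG : Function.Injective G := by
    rw [injective_iff_map_eq_zero]
    intro c hc
    by_contra hne
    have h1 := h.image_le c
    rw [hP, show P (β (combine e c)) = 0 from hc] at h1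
    have h2 := sum_norm_sq_pos hne
    simp at h1
    linarith
  let G' := LinearEquiv.ofInjectiveEndo G hG
  have hPc : Continuous P := by
    refine continuous_pi fun i => ?_
    exact Continuous.inner continuous_const J₂.continuous
  have hGc : Continuous G'.symm.toLinearMap := LinearMap.continuous_of_finiteDimensional _
  refine ⟨⟨G'.symm.toLinearMap ∘ₗ P, hGc.comp hPc⟩, fun y c => ?_⟩
  have h3 : P (β (combine e (G'.symm (P y)))) = P y := G'.apply_symm_apply (P y)
  rw [hP, map_sub]
  refine Finset.sum_eq_zero fun i _ => ?_
  change star (c i) * (P y - P (β (combine e (G'.symm (P y))))) i = 0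
  rw [h3, sub_self, Pi.zero_apply, mul_zero]

/-- Decompose `β a` along the image of the negative family and its orthogonal complement. On the
complement the form is nonnegative and, by Cauchy–Schwarz, dominates a multiple of the squared norm.
The contraction inequality then controls both components by `‖α a‖`. -/
theorem exists_norm_le (h : DenseContraction J₁ J₂ α β e f) : ∃ C, ∀ a, ‖β a‖ ≤ C * ‖α a‖ := by
  obtain ⟨D, hD⟩ := h.exists_coeff
  let εβ : (ι → ℂ) →L[ℂ] E₂ := LinearMap.toContinuousLinearMap (β ∘ₗ combine e)
  let εα : (ι → ℂ) →L[ℂ] E₁ := LinearMap.toContinuousLinearMap (α ∘ₗ combine e)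
  -- The projection onto the orthogonal complement, for the indefinite form, of the image of the
  -- negative family.
  let R : E₂ →L[ℂ] E₂ := ContinuousLinearMap.id ℂ E₂ - εβ ∘L D
  have hR : ∀ y, R y = y - β (combine e (D y)) := fun _ => rfl
  have hRo : ∀ y c, inner ℂ (β (combine e c)) (J₂ (R y)) = 0 := hD
  have hRn : ∀ y, 0 ≤ (inner ℂ (R y) (J₂ (R y))).re := fun y => h.nonneg_of_orthogonal (hRo y)
  have hu : ∀ y, ‖R y‖ ^ 2 ≤ ‖R‖ ^ 2 * (inner ℂ (R y) (J₂ (R y))).re := by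
    intro y
    set u := R y with hudef
    -- `u` is orthogonal to the part of `J₂ u` removed by `R`, so pairing `u` with `R (J₂ u)` in the
    -- form recovers the Hilbert norm of `u`.
    have h1 : (inner ℂ u (J₂ (R (J₂ u)))).re = ‖u‖ ^ 2 := by
      rw [re_krein_comm h.symm₂, hR (J₂ u), inner_sub_left, hudef, hRo, sub_zero,
        J₂.inner_map_map, ← inner_self_eq_norm_sq (𝕜 := ℂ)]
      rfl
    -- The inner square of `t • u + R (J₂ u)`, an element of the range of `R`, is a nonnegative
    -- quadratic in `t`. Its discriminant gives Cauchy–Schwarz for the semidefinite form.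
    have h2 : ∀ t : ℝ, 0 ≤ (inner ℂ u (J₂ u)).re * (t * t) + (2 * ‖u‖ ^ 2) * t +
        (inner ℂ (R (J₂ u)) (J₂ (R (J₂ u)))).re := by
      intro t
      have h3 := hRn (((t : ℂ)) • y + J₂ u)
      rw [map_add, map_smul, ← hudef, re_krein_add h.symm₂, re_krein_smul, inner_smul_left,
        Complex.conj_ofReal, Complex.re_ofReal_mul, h1, Complex.norm_real, Real.norm_eq_abs,
        sq_abs] at h3
      linarith
    have h4 := discrim_le_zero h2
    rw [discrim] at h4
    have h5 : (inner ℂ (R (J₂ u)) (J₂ (R (J₂ u)))).re ≤ ‖R‖ ^ 2 * ‖u‖ ^ 2 := by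
      refine (re_krein_le _ _).trans ?_
      rw [← mul_pow]
      gcongr
      exact (R.le_opNorm _).trans_eq (by rw [J₂.norm_map])
    rcases eq_or_ne ‖u‖ 0 with h0 | h0
    · rw [h0, zero_pow two_ne_zero]
      exact mul_nonneg (sq_nonneg _) (hRn y)
    · have h6 : 0 < ‖u‖ ^ 2 := by positivity
      have h7 := mul_le_mul_of_nonneg_left h5 (hRn y)
      rw [← hudef] at h7
      refine le_of_mul_le_mul_right ?_ h6
      linarith
  set C := ‖εα‖ with hC
  have hC0 : 0 ≤ C := norm_nonneg _
  refine ⟨‖R‖ * (1 + 2 * C) + ‖εβ‖ * (1 + 2 * C), fun a => ?_⟩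
  set d := D (β a) with hd
  set x := ‖α a‖ with hx
  have hx0 : 0 ≤ x := norm_nonneg _
  have hd0 : 0 ≤ ‖d‖ := norm_nonneg _
  have hdn := norm_sq_le_sum d
  -- Removing the negative component amounts to changing `a` by a combination of the family, so the
  -- contraction inequality applies to the projected vector as well.
  have hRa : R (β a) = β (a + combine e (-d)) := by
    rw [hR, map_add, map_neg, map_neg, sub_eq_add_neg]
  have h1 : (inner ℂ (R (β a)) (J₂ (R (β a)))).re ≤ x ^ 2 + 2 * C * x * ‖d‖ - ‖d‖ ^ 2 := by
    rw [hRa]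
    refine (h.le _).trans ?_
    rw [map_add, re_krein_add h.symm₁, krein_combine J₁ α h.neg]
    have h2 := re_krein_le J₁ (α a)
    have h3 : (inner ℂ (α a) (J₁ (α (combine e (-d))))).re ≤ x * (C * ‖d‖) := by
      refine (Complex.re_le_norm _).trans ((norm_inner_le_norm _ _).trans ?_)
      rw [J₁.norm_map]
      gcongr
      have := εα.le_opNorm (-d)
      rwa [norm_neg] at this
    simp only [Pi.neg_apply, norm_neg]
    linarith
  have h0 := hRn (β a)
  -- The quantity `x ^ 2 + 2 * C * x * ‖d‖ - ‖d‖ ^ 2` bounds a nonnegative number from above, which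
  -- fails once `‖d‖` exceeds `(1 + 2 * C) * x`.
  have h4 : ‖d‖ ≤ (1 + 2 * C) * x := by
    by_contra hlt
    rw [not_le] at hlt
    have h6 : x ≤ ‖d‖ := by nlinarith [mul_nonneg hC0 hx0]
    have h7 : x * x ≤ x * ‖d‖ := by gcongr
    have h8 : ‖d‖ ≠ 0 := fun h => by rw [h] at hlt; nlinarith [mul_nonneg hC0 hx0]
    have h9 : 0 < ‖d‖ := lt_of_le_of_ne hd0 h8.symm
    nlinarith [mul_lt_mul_of_pos_right hlt h9]
  have h5 : ‖R (β a)‖ ≤ ‖R‖ * (1 + 2 * C) * x := by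
    refine abs_le_of_sq_le_sq' ?_ (by positivity) |>.2
    refine (hu _).trans ?_
    rw [mul_assoc, mul_pow]
    gcongr
    refine h1.trans ?_
    have : 2 * C * x * ‖d‖ ≤ 2 * C * x * ((1 + 2 * C) * x) := by gcongr
    nlinarith [sq_nonneg ‖d‖, mul_nonneg hC0 (sq_nonneg x)]
  have h6 : β a = R (β a) + εβ d := by
    rw [hR]
    exact (sub_add_cancel _ _).symm
  calc ‖β a‖ = ‖R (β a) + εβ d‖ := by rw [← h6]
    _ ≤ ‖R (β a)‖ + ‖εβ d‖ := norm_add_le _ _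
    _ ≤ ‖R‖ * (1 + 2 * C) * x + ‖εβ‖ * ((1 + 2 * C) * x) := by
      gcongr
      exact (εβ.le_opNorm d).trans (by gcongr)
    _ = _ := by ring

/-- A densely defined contraction extends to an everywhere defined one, whose adjoint is a
contraction too. -/
theorem exists_adjoint_pair [CompleteSpace E₁] [CompleteSpace E₂]
    (h : DenseContraction J₁ J₂ α β e f) :
    ∃ (S : E₁ →L[ℂ] E₂) (T : E₂ →L[ℂ] E₁), (∀ a, S (α a) = β a) ∧
      (∀ F x, inner ℂ x (J₁ (T F)) = inner ℂ (S x) (J₂ F)) ∧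
      ∀ F, (inner ℂ (T F) (J₁ (T F))).re ≤ (inner ℂ F (J₂ F)).re := by
  have hS := LinearMap.extendOfNorm_eq (f := β) h.dense h.exists_norm_le
  set S : E₁ →L[ℂ] E₂ := β.extendOfNorm α
  have hSle : ∀ x, (inner ℂ (S x) (J₂ (S x))).re ≤ (inner ℂ x (J₁ x)).re := by
    intro x
    refine h.dense.induction_on (p := fun x => (inner ℂ (S x) (J₂ (S x))).re ≤ (inner ℂ x (J₁ x)).re)
      x ?_ fun a => ?_
    · refine isClosed_le ?_ ?_
      · exact Complex.continuous_re.comp (S.continuous.inner (J₂.continuous.comp S.continuous))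
      · exact Complex.continuous_re.comp (continuous_id.inner J₁.continuous)
    · rw [hS]
      exact h.le a
  -- The Hilbert space adjoint conjugated by the two involutions is the adjoint for the indefinite
  -- forms.
  let T : E₂ →L[ℂ] E₁ :=
    J₁.toContinuousLinearEquiv.toContinuousLinearMap ∘L S.adjoint ∘L
      J₂.toContinuousLinearEquiv.toContinuousLinearMap
  have hT : ∀ F, T F = J₁ (S.adjoint (J₂ F)) := fun _ => rfl
  have hadj : ∀ F x, inner ℂ x (J₁ (T F)) = inner ℂ (S x) (J₂ F) := by
    intro F x
    rw [hT, h.symm₁, ContinuousLinearMap.adjoint_inner_right]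
  refine ⟨S, T, hS, hadj, fun F => ?_⟩
  by_contra hneg
  rw [not_le] at hneg
  -- Expand both squares: the cross terms agree by adjointness, and what remains is the contraction
  -- inequality for `S`.
  have key : ∀ F x, (inner ℂ (F + S x) (J₂ (F + S x))).re ≤
      (inner ℂ (x + T F) (J₁ (x + T F))).re +
        ((inner ℂ F (J₂ F)).re - (inner ℂ (T F) (J₁ (T F))).re) := by
    intro F x
    rw [re_krein_add h.symm₁, re_krein_add h.symm₂, hadj, re_krein_comm h.symm₂ F (S x)]
    linarith [hSle x]
  -- The shift by `-S (T F)` is chosen so that in `key` the vector `x + T F` reduces to a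
  -- combination of the negative family. If `T` increased the inner square of `F`, the form would be
  -- negative at all nonzero parameters, of which there are too many.
  let Ψ : (Option ι → ℂ) →ₗ[ℂ] E₂ :=
    combineOption (S.toLinearMap ∘ₗ α ∘ₗ combine e) (F - S (T F))
  obtain ⟨c, hc, hQ⟩ := exists_ne_zero_nonneg h.card_lt
    (fun i => (innerₛₗ ℂ (f i)) ∘ₗ J₂.toLinearMap) (fun x => (inner ℂ x (J₂ x)).re)
    (fun x hx => h.nonneg x hx) Ψ
  have hΨ : Ψ c = c none • F + S (α (combine e fun i => c (some i)) - c none • T F) := by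
    simp only [Ψ, combineOption_apply, LinearMap.comp_apply, map_sub, map_smul, smul_sub]
    change S _ + _ = _
    abel
  have h1 := key (c none • F) (α (combine e fun i => c (some i)) - c none • T F)
  rw [← hΨ, map_smul, sub_add_cancel, krein_combine J₁ α h.neg, re_krein_smul, re_krein_smul,
    ← mul_sub] at h1
  replace h1 := hQ.trans h1
  by_cases h0 : c none = 0
  · have : (fun i => c (some i)) ≠ 0 := by
      intro h2
      apply hc
      funext o
      cases o with
      | none => exact h0
      | some i => exact congrFun h2 i
    have := sum_norm_sq_pos this
    rw [h0, norm_zero] at h1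
    linarith
  · have h2 : 0 < ‖c none‖ := norm_pos_iff.mpr h0
    have h3 : 0 ≤ ∑ i, ‖c (some i)‖ ^ 2 := Finset.sum_nonneg fun _ _ => by positivity
    have := mul_neg_of_pos_of_neg (pow_pos h2 2) (sub_neg.mpr hneg)
    linarith

end DenseContraction

end Krein

/-! ### Pontryagin spaces as Hilbert spaces with an involution. -/

section Model

universe u

variable {V : Type u} [AddCommGroup V] [Module ℂ V] {B : V →ₗ[ℂ] V →ₗ⋆[ℂ] ℂ}

/-- A Pontryagin space is a Hilbert space whose form is twisted by an isometric involution. -/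
theorem IsPontryagin.exists_krein_model (hB : IsPontryagin B) :
    ∃ (E : Type u) (_ : NormedAddCommGroup E) (_ : InnerProductSpace ℂ E) (_ : CompleteSpace E)
      (Φ : V ≃ₗ[ℂ] E) (J : E ≃ₗᵢ[ℂ] E), (∀ x, J (J x) = x) ∧
        ∀ f g, B f g = inner ℂ (Φ g) (J (Φ f)) := by
  obtain ⟨hH, Vp, Vm, hc, horth, ⟨hpos, hcomplete⟩, hfin, hneg⟩ := hB
  have horth' : ∀ f ∈ Vm, ∀ g ∈ Vp, B f g = 0 := fun f hf g hg => by
    rw [hH, horth g hg f hf, star_zero]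
  let p : V →ₗ[ℂ] V := Vp.projection Vm hc
  let m : V →ₗ[ℂ] V := Vm.projection Vp hc.symm
  have hp : ∀ f, p f ∈ Vp := Submodule.projection_apply_mem hc
  have hm : ∀ f, m f ∈ Vm := Submodule.projection_apply_mem hc.symm
  have hpm : ∀ f, p f + m f = f := Submodule.projection_add_projection_eq_self hc
  have hpp : ∀ f ∈ Vp, p f = f := fun f hf => Submodule.projection_apply_of_mem_left hc hf
  have hmm : ∀ f ∈ Vm, m f = f := fun f hf => Submodule.projection_apply_of_mem_left hc.symm hf
  have hpm0 : ∀ f ∈ Vm, p f = 0 := fun f hf => (Submodule.projection_apply_eq_zero_iff hc).mpr hf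
  have hmp0 : ∀ f ∈ Vp, m f = 0 := fun f hf =>
    (Submodule.projection_apply_eq_zero_iff hc.symm).mpr hf
  have hnonneg : ∀ f ∈ Vp, 0 ≤ (B f f).re := fun f hf => by
    rcases eq_or_ne f 0 with rfl | h
    · simp
    · exact (hpos f hf h).le
  have hnonpos : ∀ f ∈ Vm, (B f f).re ≤ 0 := fun f hf => by
    rcases eq_or_ne f 0 with rfl | h
    · simp
    · exact (hneg f hf h).le
  -- Reverse the sign of the form on the negative part. The arguments are swapped because `inner` is
  -- conjugate linear in its first variable and `B` in its second.
  let core : InnerProductSpace.Core ℂ V :=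
    { inner := fun f g => B (p g) (p f) - B (m g) (m f)
      conj_inner_symm := fun f g => by
        rw [map_sub, ← Complex.star_def, ← hH, ← hH]
      re_inner_nonneg := fun f => by
        have h1 := hnonneg _ (hp f)
        have h2 := hnonpos _ (hm f)
        change 0 ≤ (B (p f) (p f) - B (m f) (m f)).re
        rw [Complex.sub_re]
        linarith
      add_left := fun f g k => by
        simp only [map_add]
        ring
      smul_left := fun f g c => by
        simp only [map_smulₛₗ, smul_eq_mul, RingHom.id_apply]
        ring
      definite := fun f h => by
        have h' := congrArg Complex.re h
        rw [Complex.sub_re, Complex.zero_re] at h'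
        have h1 := hnonneg _ (hp f)
        have h2 := hnonpos _ (hm f)
        have h3 : p f = 0 := by
          by_contra hne
          have := hpos _ (hp f) hne
          linarith
        have h4 : m f = 0 := by
          by_contra hne
          have := hneg _ (hm f) hne
          linarith
        rw [← hpm f, h3, h4, add_zero] }
  let _ : NormedAddCommGroup V := core.toNormedAddCommGroup
  let _ : InnerProductSpace ℂ V := InnerProductSpace.ofCore core.toCore
  have hinner : ∀ f g : V, inner ℂ f g = B (p g) (p f) - B (m g) (m f) := fun _ _ => rfl
  have hnorm : ∀ f : V, ‖f‖ ^ 2 = (B (p f) (p f)).re - (B (m f) (m f)).re := fun f => by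
    rw [← inner_self_eq_norm_sq (𝕜 := ℂ), hinner]
    exact Complex.sub_re _ _
  have hnp : ∀ f ∈ Vp, ‖f‖ ^ 2 = (B f f).re := fun f hf => by
    rw [hnorm, hpp f hf, hmp0 f hf]
    simp
  have hpc : ∀ f, ‖p f‖ ≤ 1 * ‖f‖ := fun f => by
    rw [one_mul]
    refine abs_le_of_sq_le_sq' ?_ (norm_nonneg _) |>.2
    rw [hnp _ (hp f), hnorm f]
    linarith [hnonpos _ (hm f)]
  let pL : V →L[ℂ] V := p.mkContinuous 1 hpc
  let mL : V →L[ℂ] V := ContinuousLinearMap.id ℂ V - pL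
  have hmL : ∀ f, mL f = m f := fun f => (eq_sub_of_add_eq' (hpm f)).symm
  -- The fundamental symmetry: the identity on `Vp` and minus the identity on `Vm`.
  let s : V →ₗ[ℂ] V := p - m
  have hs : ∀ f, s f = p f - m f := fun _ => rfl
  have hps : ∀ f, p (s f) = p f := fun f => by
    rw [hs, map_sub, hpp _ (hp f), hpm0 _ (hm f), sub_zero]
  have hms : ∀ f, m (s f) = -m f := fun f => by
    rw [hs, map_sub, hmm _ (hm f), hmp0 _ (hp f), zero_sub]
  have hss : ∀ f, s (s f) = f := fun f => by
    rw [hs (s f), hps, hms, sub_neg_eq_add, hpm]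
  let J : V ≃ₗᵢ[ℂ] V :=
    { LinearEquiv.ofInvolutive s hss with
      norm_map' := fun f => by
        change ‖s f‖ = ‖f‖
        rw [← sq_eq_sq₀ (norm_nonneg _) (norm_nonneg _), hnorm, hnorm, hps, hms]
        simp }
  have hJ : ∀ f, J f = s f := fun _ => rfl
  refine ⟨V, inferInstance, inferInstance, ?_, LinearEquiv.refl ℂ V, J, hss, fun f g => ?_⟩
  · refine Metric.complete_of_cauchySeq_tendsto fun v hv => ?_
    have hpv : CauchySeq fun n => pL (v n) := pL.uniformContinuous.comp_cauchySeq hv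
    have hmv : CauchySeq fun n => mL (v n) := mL.uniformContinuous.comp_cauchySeq hv
    obtain ⟨a, ha, hlim⟩ := hcomplete (fun n => p (v n)) (fun n => hp _) fun ε hε => by
      obtain ⟨n₀, h⟩ := Metric.cauchySeq_iff.mp hpv (√ε) (Real.sqrt_pos.mpr hε)
      refine ⟨n₀, fun i hi j hj => ?_⟩
      have h1 := h i hi j hj
      rw [dist_eq_norm] at h1
      rw [← hnp _ (Vp.sub_mem (hp _) (hp _))]
      exact (Real.lt_sqrt (norm_nonneg _)).mp h1
    have hmem : ∀ n, mL (v n) ∈ Vm := fun n => by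
      rw [hmL]
      exact hm _
    have hVm : IsComplete (Vm : Set V) := Submodule.complete_of_finiteDimensional Vm
    obtain ⟨b, -, hb⟩ := cauchySeq_tendsto_of_isComplete hVm hmem hmv
    refine ⟨a + b, ?_⟩
    have h2 : Filter.Tendsto (fun n => pL (v n)) Filter.atTop (nhds a) := by
      rw [tendsto_iff_norm_sub_tendsto_zero]
      have h3 := (Real.continuous_sqrt.tendsto 0).comp hlim
      rw [Real.sqrt_zero] at h3
      refine h3.congr fun n => ?_
      change √(B (p (v n) - a) (p (v n) - a)).re = ‖p (v n) - a‖
      rw [← hnp _ (Vp.sub_mem (hp _) ha), Real.sqrt_sq (norm_nonneg _)]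
    refine (h2.add hb).congr fun n => ?_
    rw [hmL]
    exact hpm (v n)
  · rw [LinearEquiv.refl_apply, LinearEquiv.refl_apply, hJ, hinner, hps, hms]
    conv_lhs => rw [← hpm f, ← hpm g]
    simp only [map_add, LinearMap.add_apply, map_neg, LinearMap.neg_apply, sub_neg_eq_add,
      horth _ (hp f) _ (hm g), horth' _ (hm f) _ (hp g), add_zero, zero_add]

end Model

/-! ### Maximal negative families: passage to the closure and to powers. -/

section Krein

variable {E A ι : Type*} [NormedAddCommGroup E] [InnerProductSpace ℂ E]

/-- A negative family which is maximal among the elements of a dense subspace is maximal. -/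
theorem krein_nonneg_of_dense [AddCommGroup A] [Module ℂ A] [Fintype ι] [DecidableEq ι]
    {J : E ≃ₗᵢ[ℂ] E} {α : A →ₗ[ℂ] E} (hα : DenseRange α) {e : ι → A}
    (he : ∀ i j, inner ℂ (α (e i)) (J (α (e j))) = if i = j then -1 else 0)
    (hmax : ∀ a, (∀ i, inner ℂ (α (e i)) (J (α a)) = 0) → 0 ≤ (inner ℂ (α a) (J (α a))).re)
    {x : E} (hx : ∀ i, inner ℂ (α (e i)) (J x) = 0) : 0 ≤ (inner ℂ x (J x)).re := by
  -- The projection away from the family. The sign is plus because its members have inner square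
  -- `-1`. Being continuous, `R` carries nonnegativity from the dense subspace to all vectors, and
  -- it fixes those orthogonal to the family.
  let R : E → E := fun x => x + ∑ i, inner ℂ (α (e i)) (J x) • α (e i)
  have hRc : Continuous R := by
    refine continuous_id.add (continuous_finsetSum _ fun i _ => ?_)
    exact (continuous_const.inner J.continuous).smul continuous_const
  have hR : ∀ y, 0 ≤ (inner ℂ (R y) (J (R y))).re := by
    intro y
    refine hα.induction_on (p := fun y => 0 ≤ (inner ℂ (R y) (J (R y))).re) y ?_ fun a => ?_
    · exact isClosed_le continuous_const
        (Complex.continuous_re.comp (hRc.inner (J.continuous.comp hRc)))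
    · have h1 : R (α a) = α (a + ∑ i, inner ℂ (α (e i)) (J (α a)) • e i) := by
        simp only [R, map_add, map_sum, map_smul]
      rw [h1]
      refine hmax _ fun j => ?_
      simp only [map_add, map_sum, map_smul, inner_add_right, inner_sum, inner_smul_right, he]
      simp
  have h2 : R x = x := by simp [R, hx]
  rw [← h2]
  exact hR x

/-- Maximal negative families of a space give maximal negative families of its powers. -/
theorem krein_nonneg_piLp {N : ℕ} {J : E ≃ₗᵢ[ℂ] E} {f : ι → E}
    (hf : ∀ x, (∀ i, inner ℂ (f i) (J x) = 0) → 0 ≤ (inner ℂ x (J x)).re)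
    (x : PiLp 2 fun _ : Fin N => E)
    (hx : ∀ i : Fin N × ι, inner ℂ (WithLp.toLp 2 (Pi.single i.1 (f i.2)) :
      PiLp 2 fun _ : Fin N => E) (LinearIsometryEquiv.piLpCongrRight 2 (fun _ => J) x) = 0) :
    0 ≤ (inner ℂ x (LinearIsometryEquiv.piLpCongrRight 2 (fun _ => J) x)).re := by
  rw [PiLp.inner_apply, Complex.re_sum]
  refine Finset.sum_nonneg fun n _ => hf (x n) fun i => ?_
  have h := hx (n, i)
  rw [PiLp.inner_apply, Finset.sum_eq_single n] at h
  · simpa using h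
  · intro k _ hk
    simp [Pi.single_eq_of_ne hk]
  · simp

end Krein

/-! ### Negative index, density of kernel functions, and composition on coefficients. -/

section Kernel

variable {X : Type*} {p : ℕ}

/-- The number of members of a maximal negative family is the number of negative squares. -/
theorem card_negative_family {K : X → X → Matrix (Fin p) (Fin p) ℂ} {κ : ℕ}
    (hK : HasNegativeSquares K κ) {ι : Type} [Fintype ι] [DecidableEq ι]
    {e : ι → X × Fin p →₀ ℂ}
    (he : ∀ i j, pair (e i) (kmul (flat K) (e j)) = if i = j then -1 else 0)
    (hmax : ∀ a, (∀ i, pair (e i) (kmul (flat K) a) = 0) → 0 ≤ (pair a (kmul (flat K) a)).re) :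
    Fintype.card ι = κ := by
  obtain ⟨hH, hle, M, w, hw⟩ := hK
  refine le_antisymm ?_ ?_
  · obtain ⟨M', w', v, hv⟩ := exists_push e
    refine (card_le_negEigenvalueCount (hH.gram w') v (fun i j hij => ?_) fun i => ?_).trans
      (hle M' w')
    · rw [← pair_push_kmul, hv, hv, he, if_neg hij]
    · rw [← pair_push_kmul, hv, he, if_pos rfl]
      norm_num
  · by_contra! hlt
    set hA := hH.gram w
    have hcard : Fintype.card ι < Fintype.card {i // hA.eigenvalues i < 0} := by
      rwa [← Nat.card_eq_fintype_card (α := {i // hA.eigenvalues i < 0}), show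
        Nat.card {i // hA.eigenvalues i < 0} = κ from hw]
    let a : {i // hA.eigenvalues i < 0} → X × Fin p →₀ ℂ := fun i =>
      push w (hA.eigenvectorBasis i.1 : Fin M × Fin p → ℂ)
    have ha : ∀ i j, pair (a i) (kmul (flat K) (a j)) =
        if i = j then (hA.eigenvalues j.1 : ℂ) else 0 := by
      intro i j
      simp only [a]
      have h := orthonormal_iff_ite.mp hA.eigenvectorBasis.orthonormal i.1 j.1
      rw [EuclideanSpace.inner_eq_star_dotProduct, dotProduct_comm] at h
      rw [pair_push_kmul, hA.mulVec_eigenvectorBasis, dotProduct_smul, h]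
      by_cases hij : i = j
      · simp [hij]
      · simp [hij, Subtype.ext_iff.not.mp hij]
    -- With fewer members than negative eigenvalues, some nonzero combination of negative
    -- eigenvectors is orthogonal to the whole family. Maximality makes its inner square
    -- nonnegative, while the eigenvalues make it negative.
    obtain ⟨c, hc, hQ⟩ := exists_ne_zero_nonneg hcard
      (fun i => pair (e i) ∘ₗ kmul (flat K)) (fun b => (pair b (kmul (flat K) b)).re)
      (fun b hb => hmax b hb) (combine a)
    have h1 : (pair (combine a c) (kmul (flat K) (combine a c))).re =
        ∑ i, ‖c i‖ ^ 2 * hA.eigenvalues i.1 := by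
      simp only [combine_apply, map_sum, map_smul, pair_sum, pair_smul, ha, Complex.re_sum]
      refine Finset.sum_congr rfl fun i _ => ?_
      simp only [smul_eq_mul, mul_ite, mul_zero, Finset.sum_ite_eq', Finset.mem_univ, if_true]
      rw [← mul_assoc, Complex.star_def, Complex.mul_conj', ← Complex.ofReal_pow,
        ← Complex.ofReal_mul, Complex.ofReal_re]
    rw [h1] at hQ
    obtain ⟨i, hi⟩ := Function.ne_iff.mp hc
    have h2 : 0 < ‖c i‖ := norm_pos_iff.mpr hi
    refine absurd hQ (not_le.mpr (Finset.sum_neg' (fun j _ => ?_) ⟨i, Finset.mem_univ i, ?_⟩))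
    · exact mul_nonpos_of_nonneg_of_nonpos (by positivity) j.2.le
    · exact mul_neg_of_pos_of_neg (by positivity) i.2

/-- The linear combinations of the kernel functions. -/
theorem PontryaginFunctionSpace.HasKernel.exists_kernel_combination
    {P : PontryaginFunctionSpace X p} {K : X → X → Matrix (Fin p) (Fin p) ℂ}
    (hP : P.HasKernel K) :
    ∃ α : (X × Fin p →₀ ℂ) →ₗ[ℂ] P.carrier,
      (∀ a y, (α a : X → Fin p → ℂ) y.1 y.2 = kmul (flat K) a y) ∧
      ∀ f a, P.form f (α a) = pair a fun y => (f : X → Fin p → ℂ) y.1 y.2 := by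
  choose hmem hrep using hP
  let k : X × Fin p → P.carrier := fun y => ⟨_, hmem y.1 (Pi.single y.2 1)⟩
  refine ⟨Finsupp.linearCombination ℂ k, fun a y => ?_, fun f a => ?_⟩
  · induction a using Finsupp.induction_linear with
    | zero => simp
    | add a b ha hb => simp [ha, hb]
    | single x c => simp [kmul_apply, k, flat]
  · induction a using Finsupp.induction_linear with
    | zero => simp [pair_zero]
    | add a b ha hb => simp [ha, hb, pair_add]
    | single x c =>
      rw [Finsupp.linearCombination_single, map_smulₛₗ, hrep, pair_eq,
        Finsupp.sum_single_index (by simp)]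
      simp [dotProduct, Pi.single_apply, apply_ite (starRingEnd ℂ)]

theorem IsPosDefKernel.re_pair_nonneg {K : X → X → Matrix (Fin p) (Fin p) ℂ}
    (hK : IsPosDefKernel K) (a : X × Fin p →₀ ℂ) : 0 ≤ (pair a (kmul (flat K) a)).re := by
  obtain ⟨M, w, v, hv⟩ := exists_push fun _ : Unit => a
  rw [← hv (), pair_push_kmul]
  exact (Complex.nonneg_iff.mp ((hK.2 M w).dotProduct_mulVec_nonneg (v ()))).1

/-- The reproducing kernel Pontryagin space of a kernel, modelled on a Hilbert space with an
isometric involution, is the closed span of the kernel functions. -/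
theorem PontryaginFunctionSpace.dense_kernel_combination
    {P : PontryaginFunctionSpace X p} {E : Type*}
    [NormedAddCommGroup E] [InnerProductSpace ℂ E] [CompleteSpace E] {Φ : P.carrier ≃ₗ[ℂ] E}
    {J : E ≃ₗᵢ[ℂ] E} (hΦ : ∀ f g, P.form f g = inner ℂ (Φ g) (J (Φ f)))
    {α : (X × Fin p →₀ ℂ) →ₗ[ℂ] P.carrier}
    (hα : ∀ f a, P.form f (α a) = pair a fun y => (f : X → Fin p → ℂ) y.1 y.2) :
    DenseRange (Φ.toLinearMap ∘ₗ α) := by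
  have h : (LinearMap.range (Φ.toLinearMap ∘ₗ α)).topologicalClosure = ⊤ := by
    rw [Submodule.topologicalClosure_eq_top_iff, Submodule.eq_bot_iff]
    intro x hx
    rw [Submodule.mem_orthogonal] at hx
    -- By the reproducing property, a vector orthogonal to all kernel functions corresponds to a
    -- function that vanishes at every point.
    have h0 : Φ.symm (J.symm x) = 0 := by
      apply Subtype.ext
      funext z i
      have h1 := hx _ ⟨Finsupp.single (z, i) 1, rfl⟩
      have h2 := hα (Φ.symm (J.symm x)) (Finsupp.single (z, i) 1)
      rw [hΦ, Φ.apply_symm_apply, J.apply_symm_apply, pair_eq,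
        Finsupp.sum_single_index (by simp)] at h2
      rw [LinearMap.comp_apply] at h1
      change inner ℂ (Φ (α _)) x = 0 at h1
      rw [h1] at h2
      simpa using h2.symm
    simpa using h0
  exact (Submodule.dense_iff_topologicalClosure_eq_top).mpr h

/-- The action on coefficients of the adjoint of the operator `g ↦ m · (g ∘ φ)`. -/
noncomputable def pullback {Y : Type*} {q : ℕ} (m : X → Matrix (Fin q) (Fin p) ℂ) (φ : X → Y) :
    (X × Fin q →₀ ℂ) →ₗ[ℂ] (Y × Fin p →₀ ℂ) :=
  Finsupp.linearCombination ℂ fun x => ∑ i, Finsupp.single (φ x.1, i) (star (m x.1 x.2 i))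

/-- The adjoint relation on coefficients: the conjugates placed in `pullback` are undone by the
conjugate linearity of `pair`. -/
theorem pair_pullback {Y : Type*} {q : ℕ} (m : X → Matrix (Fin q) (Fin p) ℂ) (φ : X → Y)
    (a : X × Fin q →₀ ℂ) (g : Y × Fin p → ℂ) :
    pair (pullback m φ a) g = pair a fun x => ∑ i, m x.1 x.2 i * g (φ x.1, i) := by
  induction a using Finsupp.induction_linear with
  | zero => simp [pair_zero]
  | add a b ha hb => rw [map_add, pair_add, pair_add, ha, hb]
  | single x c =>
    rw [pullback, Finsupp.linearCombination_single, pair_smul, pair_sum, pair_eq,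
      Finsupp.sum_single_index (by simp)]
    congr 1
    refine Finset.sum_congr rfl fun i _ => ?_
    rw [pair_eq, Finsupp.sum_single_index (by simp), star_star]

/-- Composing the operator with its formal adjoint produces the kernel `m K(φ, φ) mᴴ`. This
identifies the inner square of the image with the subtracted term of the positive kernel. -/
theorem sum_mul_kmul_pullback {Y : Type*} {q : ℕ} (m : X → Matrix (Fin q) (Fin p) ℂ) (φ : X → Y)
    (K : Y → Y → Matrix (Fin p) (Fin p) ℂ) (a : X × Fin q →₀ ℂ) (x : X × Fin q) :
    ∑ i, m x.1 x.2 i * kmul (flat K) (pullback m φ a) (φ x.1, i) =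
      kmul (flat fun z w => m z * K (φ z) (φ w) * (m w)ᴴ) a x := by
  induction a using Finsupp.induction_linear with
  | zero => simp
  | add a b ha hb => simp only [map_add, Pi.add_apply, mul_add, Finset.sum_add_distrib, ha, hb]
  | single y c =>
    rw [pullback, Finsupp.linearCombination_single, kmul_apply _ (Finsupp.single y c),
      Finsupp.sum_single_index (by simp)]
    simp only [map_smul, map_sum, Pi.smul_apply, Finset.sum_apply, smul_eq_mul, flat,
      Matrix.mul_apply, Matrix.conjTranspose_apply, Finset.mul_sum, Finset.sum_mul]
    rw [Finset.sum_comm]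
    refine Finset.sum_congr rfl fun i _ => Finset.sum_congr rfl fun j _ => ?_
    rw [kmul_apply, Finsupp.sum_single_index (by simp), flat]
    ring

end Kernel

/-! ### The contraction into the space of `Kt` and its adjoint. -/

section Main

variable {X Y : Type*} {N p q κ : ℕ}

/-- A family of weighted composition operators between reproducing kernel Pontryagin spaces whose
negative indices match, and whose kernels dominate one another, is a contraction which has an
everywhere defined adjoint. -/
theorem exists_contraction_of_posDef (φ : X → Y) {K : Y → Y → Matrix (Fin p) (Fin p) ℂ}
    {Kt : X → X → Matrix (Fin q) (Fin q) ℂ} (hK : HasNegativeSquares K κ)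
    (hKt : HasNegativeSquares Kt (N * κ)) (m : Fin N → X → Matrix (Fin q) (Fin p) ℂ)
    (hpos : IsPosDefKernel fun z w => Kt z w - ∑ n, m n z * K (φ z) (φ w) * (m n w)ᴴ)
    (P : PontryaginFunctionSpace Y p) (hP : P.HasKernel K)
    (Pt : PontryaginFunctionSpace X q) (hPt : Pt.HasKernel Kt) :
    ∃ (T : (Fin N → P.carrier) →ₗ[ℂ] Pt.carrier) (S : Pt.carrier →ₗ[ℂ] (Fin N → P.carrier)),
      (∀ f z, (T f : X → Fin q → ℂ) z = ∑ n, m n z *ᵥ (f n : Y → Fin p → ℂ) (φ z)) ∧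
      IsAdjoint (sumForm N P.form) Pt.form T S ∧ IsContraction (sumForm N P.form) Pt.form T := by
  obtain ⟨ι, _, _, e, he, hmax⟩ := exists_negative_family hK
  obtain ⟨ι', _, _, e', he', hmax'⟩ := exists_negative_family hKt
  have hcard := card_negative_family hK he hmax
  have hcard' := card_negative_family hKt he' hmax'
  obtain ⟨E, _, _, _, Φ, J, hJ, hΦ⟩ := P.isPontryagin.exists_krein_model
  obtain ⟨E', _, _, _, Φ', J', hJ', hΦ'⟩ := Pt.isPontryagin.exists_krein_model
  obtain ⟨α, hα, hrep⟩ := hP.exists_kernel_combination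
  obtain ⟨α', hα', hrep'⟩ := hPt.exists_kernel_combination
  let ΦN : (Fin N → P.carrier) ≃ₗ[ℂ] PiLp 2 (fun _ : Fin N => E) :=
    (LinearEquiv.piCongrRight fun _ => Φ) ≪≫ₗ (WithLp.linearEquiv 2 ℂ (Fin N → E)).symm
  let JN : PiLp 2 (fun _ : Fin N => E) ≃ₗᵢ[ℂ] PiLp 2 (fun _ : Fin N => E) :=
    LinearIsometryEquiv.piLpCongrRight 2 fun _ => J
  have hΦN : ∀ f g, sumForm N P.form f g = inner ℂ (ΦN g) (JN (ΦN f)) := fun f g => by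
    rw [PiLp.inner_apply]
    change ∑ n, P.form (f n) (g n) = ∑ n, inner ℂ (Φ (g n)) (J (Φ (f n)))
    exact Finset.sum_congr rfl fun n _ => hΦ _ _
  -- The prospective adjoint on combinations of kernel functions. Working with coefficients avoids
  -- having to check that it is well defined on the functions themselves.
  let β : (X × Fin q →₀ ℂ) →ₗ[ℂ] (Fin N → P.carrier) :=
    LinearMap.pi fun n => α ∘ₗ pullback (m n) φ
  have hβ : ∀ F a, sumForm N P.form F (β a) =
      pair a fun x => ∑ n, (m n x.1 *ᵥ (F n : Y → Fin p → ℂ) (φ x.1)) x.2 := by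
    intro F a
    change ∑ n, P.form (F n) (α (pullback (m n) φ a)) = _
    simp only [hrep, pair_pullback, ← map_sum]
    congr 1
    funext x
    rw [Finset.sum_apply]
    rfl
  have hαα : ∀ a b, inner ℂ (Φ (α a)) (J (Φ (α b))) = pair a (kmul (flat K) b) := fun a b => by
    rw [← hΦ, hrep]
    simp only [hα]
  have hαα' : ∀ a b, inner ℂ (Φ' (α' a)) (J' (Φ' (α' b))) = pair a (kmul (flat Kt) b) :=
    fun a b => by
      rw [← hΦ', hrep']
      simp only [hα']
  -- The dense contraction goes from the space of `Kt` to the power of the space of `K`, opposite to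
  -- the operator sought.
  have hdata : DenseContraction J' JN (Φ'.toLinearMap ∘ₗ α') (ΦN.toLinearMap ∘ₗ β) e'
      (fun i : Fin N × ι => (WithLp.toLp 2 (Pi.single i.1 (Φ (α (e i.2)))) :
        PiLp 2 fun _ : Fin N => E)) :=
    { symm₁ := hJ'
      symm₂ := fun x => by
        ext n
        exact hJ _
      dense := PontryaginFunctionSpace.dense_kernel_combination hΦ' hrep'
      le := fun a => by
        change (inner ℂ (ΦN (β a)) (JN (ΦN (β a)))).re ≤
          (inner ℂ (Φ' (α' a)) (J' (Φ' (α' a)))).re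
        rw [← hΦN, hβ, hαα', ← sub_nonneg, ← Complex.sub_re, ← map_sub]
        convert hpos.re_pair_nonneg a using 3
        funext x
        have h1 : ∀ n, (m n x.1 *ᵥ (β a n : Y → Fin p → ℂ) (φ x.1)) x.2 =
            kmul (flat fun z w => m n z * K (φ z) (φ w) * (m n w)ᴴ) a x := fun n => by
          rw [← sum_mul_kmul_pullback]
          change ∑ i, m n x.1 x.2 i * (α (pullback (m n) φ a) : Y → Fin p → ℂ) (φ x.1) i = _
          exact Finset.sum_congr rfl fun i _ =>
            congrArg (m n x.1 x.2 i * ·) (hα (pullback (m n) φ a) (φ x.1, i))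
        simp only [Pi.sub_apply, h1, kmul_apply, flat, Matrix.sub_apply, Matrix.sum_apply,
          Finsupp.sum, mul_sub, Finset.sum_sub_distrib, Finset.mul_sum]
        rw [Finset.sum_comm]
      neg := fun i j => (hαα' _ _).trans (he' i j)
      nonneg := krein_nonneg_piLp fun x hx =>
        krein_nonneg_of_dense (α := Φ.toLinearMap ∘ₗ α)
          (PontryaginFunctionSpace.dense_kernel_combination hΦ hrep)
          (fun i j => (hαα _ _).trans (he i j))
          (fun a ha => by
            change 0 ≤ (inner ℂ (Φ (α a)) (J (Φ (α a)))).re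
            rw [hαα]
            exact hmax a fun i => (hαα _ _).symm.trans (ha i)) hx
      -- Here the matching of indices enters: `N` copies of a family of size `κ` against one family
      -- of size `N * κ`.
      card_le := by simp [hcard, hcard'] }
  obtain ⟨S, T, hS, hadj, hT⟩ := hdata.exists_adjoint_pair
  have hadj' : IsAdjoint (sumForm N P.form) Pt.form
      (Φ'.symm.toLinearMap ∘ₗ T.toLinearMap ∘ₗ ΦN.toLinearMap)
      (ΦN.symm.toLinearMap ∘ₗ S.toLinearMap ∘ₗ Φ'.toLinearMap) := fun F g => by
    rw [hΦ', hΦN]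
    change inner ℂ (Φ' g) (J' (Φ' (Φ'.symm (T (ΦN F))))) =
      inner ℂ (ΦN (ΦN.symm (S (Φ' g)))) (JN (ΦN F))
    rw [Φ'.apply_symm_apply, ΦN.apply_symm_apply, hadj]
  refine ⟨_, _, fun F z => ?_, hadj', fun F => ?_⟩
  · funext j
    -- Evaluation of component `j` at `z` is pairing with a kernel function, whose image under the
    -- adjoint is known explicitly through `β`.
    have h1 := hadj' F (α' (Finsupp.single (z, j) 1))
    have h2 : ΦN.symm (S (Φ' (α' (Finsupp.single (z, j) 1)))) = β (Finsupp.single (z, j) 1) := by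
      rw [LinearEquiv.symm_apply_eq]
      exact hS _
    rw [hrep'] at h1
    change _ = sumForm N P.form F (ΦN.symm (S (Φ' (α' (Finsupp.single (z, j) 1))))) at h1
    rw [h2, hβ, pair_eq, pair_eq, Finsupp.sum_single_index (by simp),
      Finsupp.sum_single_index (by simp)] at h1
    rw [Finset.sum_apply]
    simpa using h1
  · rw [hΦ', hΦN]
    change (inner ℂ (Φ' (Φ'.symm (T (ΦN F)))) (J' (Φ' (Φ'.symm (T (ΦN F)))))).re ≤ _
    rw [Φ'.apply_symm_apply]
    exact hT _

end Main

end PontryaginKernel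

open PontryaginKernel in
theorem mainTheorem3 (N : ℕ) (hN : 1 ≤ N) (Ω : Set ℂ) (hΩ : ∀ z ∈ Ω, z ^ N ∈ Ω) (p q κ : ℕ)
    (K : Ω → Ω → Matrix (Fin p) (Fin p) ℂ) (Kt : Ω → Ω → Matrix (Fin q) (Fin q) ℂ)
    (hK : HasNegativeSquares K κ) (hKt : HasNegativeSquares Kt (N * κ))
    (m : Fin N → Ω → Matrix (Fin q) (Fin p) ℂ)
    (hpos : IsPosDefKernel fun z w =>
      Kt z w - ∑ n, m n z * K (powMap hΩ z) (powMap hΩ w) * (m n w)ᴴ)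
    (P : PontryaginFunctionSpace Ω p) (hP : P.HasKernel K)
    (Pt : PontryaginFunctionSpace Ω q) (hPt : Pt.HasKernel Kt) :
    (∃ T : (Fin N → P.carrier) →ₗ[ℂ] Pt.carrier,
      (∀ f z, (T f : Ω → Fin q → ℂ) z =
        ∑ n, m n z *ᵥ (f n : Ω → Fin p → ℂ) (powMap hΩ z)) ∧
      IsContraction (sumForm N P.form) Pt.form T) ∧
    ∃ (T : Fin N → P.carrier →ₗ[ℂ] Pt.carrier) (S : Fin N → Pt.carrier →ₗ[ℂ] P.carrier),
      (∀ n g z, (T n g : Ω → Fin q → ℂ) z =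
        m n z *ᵥ (g : Ω → Fin p → ℂ) (powMap hΩ z)) ∧
      (∀ n, IsAdjoint P.form Pt.form (T n) (S n)) ∧
      ∀ F : Fin N → Pt.carrier, ∃ f : Pt.carrier, ∀ z, (f : Ω → Fin q → ℂ) z =
        ∑ n, m n z *ᵥ (S n (F n) : Ω → Fin p → ℂ) (powMap hΩ z) := by
  obtain ⟨T, S, hT, hadj, hcontr⟩ :=
    exists_contraction_of_posDef (powMap hΩ) hK hKt m hpos P hP Pt hPt
  -- Each single operator is the restriction of `T` to one summand, and its adjoint is the
  -- corresponding coordinate of `S`. The decomposed element is `T` applied to the tuple of the `S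
  -- (F n) n`.
  refine ⟨⟨T, hT, hcontr⟩, fun n => T ∘ₗ LinearMap.single ℂ (fun _ => P.carrier) n,
    fun n => LinearMap.proj n ∘ₗ S, fun n g z => ?_, fun n g h => ?_,
    fun F => ⟨T fun n => S (F n) n, fun z => hT _ z⟩⟩
  · rw [LinearMap.comp_apply, hT, Finset.sum_eq_single n]
    · simp
    · intro k _ hk
      simp [Pi.single_eq_of_ne hk]
    · simp
  · rw [LinearMap.comp_apply, hadj]
    change ∑ k, P.form (Pi.single (M := fun _ => P.carrier) n g k) (S h k) = P.form g (S h n)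
    rw [Finset.sum_eq_single n]
    · simp
    · intro k _ hk
      simp [Pi.single_eq_of_ne hk]
    · simp
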